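/- Let $n\ge 2$. For each $k\ge 0$ let $H_k$ be the space of real homogeneous harmonic polynomials of degree $k$ on $\mathbb{R}^n$, let $d_k=\dim H_k$, and let $Y_{k,1},\dots,Y_{k,d_k}$ be a basis of $H_k$ whose restrictions to the sphere $\mathbb{S}^{n-1}$ are orthonormal for the surface measure normalized to total mass $1$. The Klein--Dirac quadric is $\mathrm{KDQ}=(\mathbb{C}\times\mathbb{S}^{n-1})/\mathbb{Z}_2$, the quotient space in which $(\zeta,\theta)$ and $(-\zeta,-\theta)$ are identified; the class of $(\zeta,\theta)$ is written $\zeta\theta$, and $B_R=\{\zeta\theta: |\zeta|<R\}$. For $\theta\in\mathbb{S}^{n-1}$ and $x\in\mathbb{R}^n$ with $|x|<|\zeta|$ let $$r(\zeta\theta-x)=\sqrt{\zeta^2-2\zeta\langle\theta,x\rangle+|x|^2},$$ with the branch that is continuous in $x$ and equal to $\zeta$ at $x=0$. For a signed measure $\mu$ on $\mathbb{R}^n$ put $$\widehat\mu(\zeta,\theta)=\int \frac{\zeta^{n-1}}{r(\zeta\theta-x)^n}\,d\mu(x),$$ and let the component measure $\mu_{k,\ell}$ be the signed measure on $[0,\infty)$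 with $\int_0^\infty F(r)\,d\mu_{k,\ell}(r)=\int_{\mathbb{R}^n}F(|x|)\,Y_{k,\ell}(x/|x|)\,d\mu(x)$ for all continuous compactly supported $F$ (at $x=0$ the factor $Y_{k,\ell}(x/|x|)$ is read as the constant $Y_{0,1}$ if $k=0$ and as $0$ if $k\ge1$). Let $R>0$ and let $\mu$ be a signed measure of finite variation on $\mathbb{R}^n$ supported in the closed ball $\{|x|\le R\}$. Then for all $\zeta\in\mathbb{C}$ with $|\zeta|>R$ and all $\theta\in\mathbb{S}^{n-1}$ the integrals defining $\widehat\mu(\zeta,\theta)$ and those in the series below converge absolutely, and $$\widehat\mu(\zeta,\theta)=\sum_{k=0}^\infty\sum_{\ell=1}^{d_k}\zeta^{-k+1}\,Y_{k,\ell}(\theta)\int_{[0,R]}\frac{r^k}{\zeta^2-r^2}\,d\mu_{k,\ell}(r),$$ where the family of all terms indexed by $(k,\ell)$ is absolutely summable. The series converges absolutely and uniformly on compact sets outside the closed ball: for every compact $K\subset\mathrm{KDQ}\setminus\overline{B_R}$ there are numbers $M_{k,\ell}$ with $\sum_{k,\ell}M_{k,\ell}<\infty$ such that the $(k,\ell)$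 term has absolute value at most $M_{k,\ell}$ at all $(\zeta,\theta)$ with $\zeta\theta\in K$. -/

import Mathlib

open MeasureTheory Metric Set
open scoped InnerProductSpace

noncomputable section

/-- Euclidean space `ℝⁿ`. -/
abbrev EucSpace (n : ℕ) : Type := EuclideanSpace ℝ (Fin n)

/-- The unit sphere `𝕊ⁿ⁻¹` in `ℝⁿ`. -/
abbrev UnitSphere (n : ℕ) : Type := sphere (0 : EucSpace n) 1

/-! ### The Klein-Dirac quadric -/

/-- The antipodal identification `(ζ, θ) ∼ (-ζ, -θ)` on `ℂ × 𝕊ⁿ⁻¹`. -/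
def kdqSetoid (n : ℕ) : Setoid (ℂ × UnitSphere n) where
  r p q := p = q ∨ p = (-q.1, -q.2)
  iseqv :=
    { refl := fun _ => Or.inl rfl
      symm := by
        rintro p q (h | h)
        · exact Or.inl h.symm
        · right; subst h; simp
      trans := by
        rintro p q r (h | h) (h' | h') <;> subst h <;> subst h' <;> simp }

/-- The Klein-Dirac quadric `KDQ = (ℂ × 𝕊ⁿ⁻¹) / ℤ₂`. -/
def KDQ (n : ℕ) : Type := Quotient (kdqSetoid n)

/-- The quotient topology on the Klein-Dirac quadric. -/
instance KDQ.instTopologicalSpace (n : ℕ) : TopologicalSpace (KDQ n) :=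
  inferInstanceAs (TopologicalSpace (Quotient (kdqSetoid n)))

/-- The point `ζθ` of the Klein-Dirac quadric. -/
def KDQ.mk {n : ℕ} (ζ : ℂ) (θ : UnitSphere n) : KDQ n :=
  Quotient.mk (kdqSetoid n) (ζ, θ)

/-- The ball `B_R = {ζθ : |ζ| < R}` in the Klein-Dirac quadric. -/
def KDQ.ball (n : ℕ) (R : ℝ) : Set (KDQ n) :=
  {p | ∃ (ζ : ℂ) (θ : UnitSphere n), ‖ζ‖ < R ∧ p = KDQ.mk ζ θ}

/-! ### Spherical harmonics -/

/-- The Laplacian `∑ ∂²/∂xᵢ²` on real polynomials in `n` variables. -/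
def polyLaplacian (n : ℕ) : MvPolynomial (Fin n) ℝ →ₗ[ℝ] MvPolynomial (Fin n) ℝ :=
  ∑ i : Fin n,
    (MvPolynomial.pderiv i).toLinearMap ∘ₗ (MvPolynomial.pderiv (R := ℝ) i).toLinearMap

/-- The real vector space of harmonic polynomials on `ℝⁿ` that are homogeneous of degree `k`;
restriction to the unit sphere identifies it with the space of spherical harmonics of degree `k`. -/
def harmonicSpace (n k : ℕ) : Submodule ℝ (MvPolynomial (Fin n) ℝ) :=
  MvPolynomial.homogeneousSubmodule (Fin n) ℝ k ⊓ LinearMap.ker (polyLaplacian n)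

/-- The number `d_k`, the dimension of the space of spherical harmonics of degree `k`. -/
def harmonicDim (n k : ℕ) : ℕ := Module.finrank ℝ (harmonicSpace n k)

/-- The value of a homogeneous harmonic polynomial at a point of `ℝⁿ`. -/
def harmonicEval {n k : ℕ} (p : harmonicSpace n k) (x : EucSpace n) : ℝ :=
  MvPolynomial.eval (fun i => x i) (p : MvPolynomial (Fin n) ℝ)

/-- `Y k 0, …, Y k (d_k - 1)` is an orthonormal basis of the spherical harmonics of degree `k`,
for the normalized (total mass one) surface measure on the unit sphere. -/
def IsOrthonormalHarmonicBasis (n : ℕ)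
    (Y : ∀ k : ℕ, Module.Basis (Fin (harmonicDim n k)) ℝ (harmonicSpace n k)) : Prop :=
  ∀ (k : ℕ) (l m : Fin (harmonicDim n k)),
    (⨍ θ : UnitSphere n, harmonicEval (Y k l) θ * harmonicEval (Y k m) θ
      ∂((volume : Measure (EucSpace n)).toSphere)) = if l = m then 1 else 0

/-! ### The Hua-Aronszajn kernel and the Stieltjes-Markov transform -/

/-- `r(ζθ - x)`: the square root of `ζ² - 2ζ⟨θ, x⟩ + |x|²`, on the branch that, for `|x| < |ζ|`,
is continuous in `x` and equals `ζ` at `x = 0`. -/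
def aronszajnRoot {n : ℕ} (ζ : ℂ) (θ x : EucSpace n) : ℂ :=
  ζ * (1 - 2 * (⟪θ, x⟫_ℝ : ℂ) / ζ + (‖x‖ : ℂ) ^ 2 / ζ ^ 2) ^ (1 / 2 : ℂ)

theorem aronszajnRoot_sq {n : ℕ} {ζ : ℂ} (hζ : ζ ≠ 0) (θ x : EucSpace n) :
    aronszajnRoot ζ θ x ^ 2 = ζ ^ 2 - 2 * ζ * (⟪θ, x⟫_ℝ : ℂ) + (‖x‖ : ℂ) ^ 2 := by
  unfold aronszajnRoot
  rw [mul_pow, ← Complex.cpow_nat_mul]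
  norm_num
  field_simp

/-- For `|x| < |ζ|` the principal root in `aronszajnRoot` is taken off its branch cut. -/
theorem aronszajnRoot_slitPlane {n : ℕ} {ζ : ℂ} {θ x : EucSpace n} (hθ : ‖θ‖ = 1)
    (hx : ‖x‖ < ‖ζ‖) :
    1 - 2 * (⟪θ, x⟫_ℝ : ℂ) / ζ + (‖x‖ : ℂ) ^ 2 / ζ ^ 2 ∈ Complex.slitPlane := by
  have hζ : 0 < ‖ζ‖ := (norm_nonneg x).trans_lt hx
  have hs : |⟪θ, x⟫_ℝ| ≤ ‖x‖ := by simpa [hθ] using abs_real_inner_le_norm θ x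
  have hu : ‖x‖ ^ 2 * (ζ⁻¹.re ^ 2 + ζ⁻¹.im ^ 2) < 1 := by
    have h1 : ζ⁻¹.re ^ 2 + ζ⁻¹.im ^ 2 = ‖ζ⁻¹‖ ^ 2 := by
      rw [← Complex.normSq_eq_norm_sq, Complex.normSq_apply]; ring
    rw [h1, norm_inv, ← mul_pow]
    have : ‖x‖ * ‖ζ‖⁻¹ < 1 := by
      rw [← div_eq_mul_inv]; exact (div_lt_one hζ).2 hx
    have h0 : 0 ≤ ‖x‖ * ‖ζ‖⁻¹ := by positivity
    nlinarith
  rw [div_eq_mul_inv, div_eq_mul_inv, ← inv_pow]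
  generalize ζ⁻¹ = u at hu
  generalize ⟪θ, x⟫_ℝ = s at hs
  have hρ := norm_nonneg x
  generalize ‖x‖ = ρ at hu hs hρ
  obtain ⟨p, q⟩ := u
  rw [Complex.mem_slitPlane_iff]
  simp [pow_two] at hu ⊢
  by_cases hq : q = 0
  · left
    subst hq
    obtain ⟨h1, h2⟩ := abs_le.1 hs
    have h3 : ρ * |p| < 1 := by
      by_contra hcon
      have := abs_mul_abs_self p
      nlinarith
    have h4 : s * p ≤ ρ * |p| := by
      calc s * p ≤ |s * p| := le_abs_self _
        _ = |s| * |p| := abs_mul _ _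
        _ ≤ _ := by gcongr
    have := abs_mul_abs_self p
    nlinarith [sq_nonneg (1 - ρ * |p|), mul_pos (sub_pos.2 h3) (sub_pos.2 h3)]
  · by_cases h : s = ρ * ρ * p
    · left; subst h; nlinarith
    · right
      intro h'
      apply h
      have : q * (s - ρ * ρ * p) = 0 := by linarith
      rcases mul_eq_zero.1 this with h0 | h0
      · exact absurd h0 hq
      · linarith

/-- The Hua-Aronszajn kernel `K(ζθ; x) = ζⁿ⁻¹ / r(ζθ - x)ⁿ`. -/
def huaAronszajnKernel (n : ℕ) (ζ : ℂ) (θ x : EucSpace n) : ℂ :=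
  ζ ^ (n - 1) / aronszajnRoot ζ θ x ^ n

/-- The multidimensional Stieltjes-Markov transform of a signed measure on `ℝⁿ`. -/
def stieltjesMarkov {n : ℕ} (μ : SignedMeasure (EucSpace n)) (ζ : ℂ) (θ : UnitSphere n) : ℂ :=
  ∫ᵛ x, huaAronszajnKernel n ζ θ x ∂<•μ

/-! ### Component measures -/

/-- The component measure of `μ` with respect to `p`: the image under `x ↦ |x|` of the signed
measure `p(x/|x|) dμ(x)`. It is carried by `[0, ∞)`. At `x = 0` the convention `x/|x| = 0` is in
force, so `p(x/|x|)` is there the constant `p` in degree `0`, and `0` in positive degree. -/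
def componentMeasure {n k : ℕ} (μ : SignedMeasure (EucSpace n)) (p : harmonicSpace n k) :
    SignedMeasure ℝ :=
  (VectorMeasure.withDensity μ (fun x : EucSpace n => harmonicEval p (‖x‖⁻¹ • x))
    (ContinuousLinearMap.lsmul ℝ ℝ)).map (fun x : EucSpace n => ‖x‖)

theorem norm_normalize_le_one {n : ℕ} (x : EucSpace n) : ‖‖x‖⁻¹ • x‖ ≤ 1 := by
  rw [norm_smul, norm_inv, norm_norm]
  exact inv_mul_le_one

theorem continuous_harmonicEval {n k : ℕ} (p : harmonicSpace n k) :
    Continuous (harmonicEval p) := by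
  unfold harmonicEval
  exact (MvPolynomial.continuous_eval _).comp (by fun_prop)

theorem measurable_harmonicEval_normalize {n k : ℕ} (p : harmonicSpace n k) :
    Measurable (fun x : EucSpace n => harmonicEval p (‖x‖⁻¹ • x)) :=
  (continuous_harmonicEval p).measurable.comp (by fun_prop)

theorem exists_bound_harmonicEval {n k : ℕ} (p : harmonicSpace n k) :
    ∃ C : ℝ, ∀ x : EucSpace n, ‖harmonicEval p (‖x‖⁻¹ • x)‖ ≤ C := by
  obtain ⟨C, hC⟩ := (isCompact_closedBall (0 : EucSpace n) 1).exists_bound_of_continuousOn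
    (continuous_harmonicEval p).continuousOn
  exact ⟨C, fun x => hC _ (by simpa using norm_normalize_le_one x)⟩

/-- Integration against a signed measure with a bounded density. -/
theorem integral_withDensity_bounded {X : Type*} [MeasurableSpace X] (μ : SignedMeasure X)
    {g f : X → ℝ} (hg : Measurable g) {C : ℝ} (hC : ∀ x, ‖g x‖ ≤ C)
    (hf : StronglyMeasurable f) {D : ℝ} (hD : ∀ x, ‖f x‖ ≤ D) :
    ∫ᵛ x, f x ∂<•(VectorMeasure.withDensity μ g (ContinuousLinearMap.lsmul ℝ ℝ)) =
      ∫ᵛ x, f x * g x ∂<•μ := by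
  have hfin : ∀ ν : SignedMeasure X, IsFiniteMeasure ν.variation := fun ν => by
    rw [← SignedMeasure.totalVariation_eq_variation]; infer_instance
  have hfμ := hfin μ
  have hgi : VectorMeasure.Integrable μ g :=
    Integrable.of_bound hg.aestronglyMeasurable C (Filter.Eventually.of_forall hC)
  set ν := VectorMeasure.withDensity μ g (ContinuousLinearMap.lsmul ℝ ℝ) with hν
  have hfν := hfin ν
  rcases isEmpty_or_nonempty X with hX | ⟨⟨x₀⟩⟩
  · simp [VectorMeasure.integral_of_isEmpty]
  have hD0 : 0 ≤ D := (norm_nonneg _).trans (hD x₀)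
  have hSi : ∀ (ρ : SignedMeasure X) (s : SimpleFunc X ℝ), VectorMeasure.Integrable ρ s :=
    fun ρ s => by have := hfin ρ; exact s.integrable_of_isFiniteMeasure
  have hSgi : ∀ s : SimpleFunc X ℝ, VectorMeasure.Integrable μ (fun x => s x * g x) :=
    fun s => (hSi μ s).mul_bdd (c := C) hg.aestronglyMeasurable (Filter.Eventually.of_forall hC)
  have key : ∀ s : SimpleFunc X ℝ, ∫ᵛ x, s x ∂<•ν = ∫ᵛ x, s x * g x ∂<•μ := by
    intro s
    induction s using SimpleFunc.induction with
    | const c hs =>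
      rename_i s
      have h1 : ∀ x, s.indicator (fun _ : X => c) x * g x = c • s.indicator g x := fun x => by
        by_cases hx : x ∈ s <;> simp [hx]
      have h2 : (⇑((SimpleFunc.const X c).piecewise s hs (SimpleFunc.const X 0)) : X → ℝ)
          = s.indicator (fun _ => c) := by
        classical
        ext x; by_cases hx : x ∈ s <;> simp [hx]
      simp only [h2, h1]
      rw [VectorMeasure.integral_indicator_const _ hs, hν, VectorMeasure.withDensity_apply hgi,
        VectorMeasure.integral_fun_smul,
        VectorMeasure.integral_indicator hs]
      have h3 : (ContinuousLinearMap.lsmul ℝ ℝ : ℝ →L[ℝ] ℝ →L[ℝ] ℝ).flip =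
          ContinuousLinearMap.lsmul ℝ ℝ := by
        ext; simp
      rw [h3]
      simp
    | add _ h1 h2 =>
      simp only [SimpleFunc.coe_add, Pi.add_apply, add_mul]
      rw [VectorMeasure.integral_fun_add (hSi _ _) (hSi _ _),
        VectorMeasure.integral_fun_add (hSgi _) (hSgi _), h1, h2]
  have hl : Filter.Tendsto (fun n : ℕ => ∫ᵛ x, hf.approxBounded D n x ∂<•ν) Filter.atTop
      (nhds (∫ᵛ x, f x ∂<•ν)) := by
    apply VectorMeasure.tendsto_integral_of_dominated_convergence (fun _ => D)
    · exact fun n => (hSi ν _).1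
    · exact integrable_const D
    · exact fun n => Filter.Eventually.of_forall fun x => hf.norm_approxBounded_le hD0 n x
    · exact Filter.Eventually.of_forall fun x => hf.tendsto_approxBounded_of_norm_le (hD x)
  have hr : Filter.Tendsto (fun n : ℕ => ∫ᵛ x, hf.approxBounded D n x * g x ∂<•μ) Filter.atTop
      (nhds (∫ᵛ x, f x * g x ∂<•μ)) := by
    apply VectorMeasure.tendsto_integral_of_dominated_convergence (fun _ => D * C)
    · exact fun n => (hSgi _).1
    · exact integrable_const _
    · refine fun n => Filter.Eventually.of_forall fun x => ?_
      rw [norm_mul]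
      exact mul_le_mul (hf.norm_approxBounded_le hD0 n x) (hC x) (norm_nonneg _) hD0
    · exact Filter.Eventually.of_forall fun x =>
        (hf.tendsto_approxBounded_of_norm_le (hD x)).mul_const _
  simp only [key] at hl
  exact tendsto_nhds_unique hl hr

/-- The defining identity of the component measures. -/
theorem integral_componentMeasure {n k : ℕ} (μ : SignedMeasure (EucSpace n))
    (p : harmonicSpace n k) {F : ℝ → ℝ} (hF : Continuous F) (hc : HasCompactSupport F) :
    ∫ᵛ r, F r ∂<•(componentMeasure μ p) =
      ∫ᵛ x, F ‖x‖ * harmonicEval p (‖x‖⁻¹ • x) ∂<•μ := by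
  obtain ⟨C, hC⟩ := exists_bound_harmonicEval p
  obtain ⟨D, hD⟩ := hF.bounded_above_of_compact_support hc
  have hFn : Continuous (fun x : EucSpace n => F ‖x‖) := hF.comp continuous_norm
  unfold componentMeasure
  rw [VectorMeasure.integral_map measurable_norm hF.aestronglyMeasurable]
  · exact integral_withDensity_bounded μ (measurable_harmonicEval_normalize p) hC
      hFn.stronglyMeasurable (fun x => hD _)
  · rw [VectorMeasure.Integrable, ← SignedMeasure.totalVariation_eq_variation]
    exact Integrable.of_bound hFn.aestronglyMeasurable D (Filter.Eventually.of_forall fun x => hD _)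

end

/-!
With `w = ζ⁻¹`, the kernel `ζ ^ (n - 1) / r(ζθ - x) ^ n` equals
`ζ⁻¹ (1 - 2 ⟨θ, x⟩ w + |x|² w²) ^ (-n / 2)`, which is `ζ / (ζ² - |x|²)` times the Poisson kernel
`(1 - |x|² w²) (1 - 2 ⟨θ, x⟩ w + |x|² w²) ^ (-n / 2)`. As a formal power series in `w` the Poisson
kernel is harmonic in `x`, so its `k`-th coefficient is a harmonic polynomial, the zonal harmonic
`Z_k(θ, x)`, and the addition theorem `∑ ℓ, Y_{k,ℓ}(θ) Y_{k,ℓ}(x) = Z_k(θ, x)` yields the pointwise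
expansion of the kernel.

The addition theorem says that `Z_k(θ, ·)` represents evaluation at `θ` on harmonic polynomials of
degree `k` for the spherical mean. Gaussian integration by parts determines the Gaussian functional
on polynomials, which turns the pairing with a coefficient of a generating series into a formal
computation, and polar coordinates relate Gaussian means to spherical means.

At `θ = x` the addition theorem gives `∑ ℓ, Y_{k,ℓ}(θ)² = d_k`, so `|Y_{k,ℓ}(θ)| ≤ √d_k`; since
`d_k` is a Taylor coefficient of a function analytic in the unit disc, the expansion is dominated by
a summable family for `|x| ≤ R < |ζ|` and may be integrated term by term.
-/

section PowerSeries

open PowerSeries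

section Derivation

variable {R B : Type*} [CommRing R] [CommRing B] [Algebra R B] (D : Derivation R B B)

theorem mul_derivation_sq_mul_pow (g q : B) (n : ℕ) :
    q * D (g ^ 2 * q ^ n) = g * q ^ n * (2 * q * D g + n * g * D q) := by
  have hn : (n : B) * q ^ (n - 1) * q = n * q ^ n := by
    cases n <;> simp [pow_succ, mul_assoc]
  simp only [Derivation.leibniz, Derivation.leibniz_pow, smul_eq_mul, nsmul_eq_mul]
  linear_combination g ^ 2 * D q * hn

theorem two_mul_mul_derivation_of_sq_mul_pow_eq_one {g q : B} {n : ℕ} (h : g ^ 2 * q ^ n = 1) :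
    2 * q * D g = -(n * g * D q) := by
  have hD := mul_derivation_sq_mul_pow D g q n
  rw [h, D.map_one_eq_zero] at hD
  linear_combination -g * hD - (2 * q * D g + n * g * D q) * h

end Derivation

section Formal

variable {A : Type*} [CommRing A]

/-- The power series `1 - 2 s w + ρ w²` in the variable `w`; it is `|y - w x|²` for `|y| = 1`,
`s = ⟨y, x⟩` and `ρ = |x|²`. -/
noncomputable def gegenbauerQuadratic (s ρ : A) : A⟦X⟧ := 1 - 2 * C s * X + C ρ * X ^ 2

theorem isUnit_gegenbauerQuadratic (s ρ : A) : IsUnit (gegenbauerQuadratic s ρ) :=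
  isUnit_iff_constantCoeff.2 (by simp [gegenbauerQuadratic])

theorem derivative_gegenbauerQuadratic (s ρ : A) :
    d⁄dX A (gegenbauerQuadratic s ρ) = -2 * (C s - C ρ * X) := by
  have h2 : (2 : A⟦X⟧) = C 2 := (map_ofNat C 2).symm
  simp only [gegenbauerQuadratic, h2, map_add, map_sub, Derivation.leibniz, derivative_pow,
    derivative_one, derivative_C, derivative_X, smul_eq_mul]
  push_cast [← h2]
  ring

variable [Algebra ℚ A]

/-- The homogenized Gegenbauer polynomials of index `n / 2` in `s` and `ρ`. The three-term
recurrence makes sense over every `ℚ`-algebra, so that `s` and `ρ` can be numbers as well as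
polynomials. -/
noncomputable def gegenbauerCoeff (n : ℕ) (s ρ : A) : ℕ → A
  | 0 => 1
  | 1 => n * s
  | k + 2 => (k + 2 : ℚ)⁻¹ • ((2 * k + 2 + n) * s * gegenbauerCoeff n s ρ (k + 1)
      - (k + n) * ρ * gegenbauerCoeff n s ρ k)

theorem gegenbauerCoeff_recurrence (n : ℕ) (s ρ : A) (k : ℕ) :
    (k + 2) * gegenbauerCoeff n s ρ (k + 2) =
      (2 * k + 2 + n) * s * gegenbauerCoeff n s ρ (k + 1)
        - (k + n) * ρ * gegenbauerCoeff n s ρ k := by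
  have hk : (k + 2 : ℚ) ≠ 0 := by positivity
  have hA : (k + 2 : A) = algebraMap ℚ A (k + 2) := by simp [map_ofNat]
  rw [gegenbauerCoeff, hA, ← Algebra.smul_def, smul_inv_smul₀ hk]

theorem map_gegenbauerCoeff {B : Type*} [CommRing B] [Algebra ℚ B] (φ : A →+* B)
    (n : ℕ) (s ρ : A) : ∀ k : ℕ,
    φ (gegenbauerCoeff n s ρ k) = gegenbauerCoeff n (φ s) (φ ρ) k
  | 0 => by simp [gegenbauerCoeff]
  | 1 => by simp [gegenbauerCoeff]
  | k + 2 => by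
    simp [gegenbauerCoeff, map_rat_smul, map_ofNat, map_gegenbauerCoeff φ n s ρ k,
      map_gegenbauerCoeff φ n s ρ (k + 1)]

/-- The generating series of the Gegenbauer polynomials of index `n / 2`, that is
`(1 - 2 s w + ρ w²) ^ (-n / 2)` as a formal power series in `w`. -/
noncomputable def gegenbauerSeries (n : ℕ) (s ρ : A) : A⟦X⟧ := mk (gegenbauerCoeff n s ρ)

theorem gegenbauerQuadratic_mul_derivative (n : ℕ) (s ρ : A) :
    gegenbauerQuadratic s ρ * d⁄dX A (gegenbauerSeries n s ρ) =
      (n : A⟦X⟧) * (C s - C ρ * X) * gegenbauerSeries n s ρ := by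
  set G := gegenbauerSeries n s ρ with hG
  have hL : gegenbauerQuadratic s ρ * d⁄dX A G =
      d⁄dX A G - C (2 * s) * (X * d⁄dX A G) + C ρ * (X * (X * d⁄dX A G)) := by
    rw [gegenbauerQuadratic, map_mul, map_ofNat]; ring
  have hR : (n : A⟦X⟧) * (C s - C ρ * X) * G = C (n * s) * G - C (n * ρ) * (X * G) := by
    simp only [map_mul, map_natCast]; ring
  ext k
  rw [hL, hR]
  obtain _ | _ | k := k <;>
    simp only [map_add, map_sub, coeff_C_mul, coeff_succ_X_mul, coeff_zero_X_mul,
      coeff_derivative, hG, gegenbauerSeries, coeff_mk]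
  · simp [gegenbauerCoeff]
  · have := gegenbauerCoeff_recurrence n s ρ 0
    simp only [gegenbauerCoeff, Nat.cast_zero] at this ⊢
    push_cast
    linear_combination this
  · have := gegenbauerCoeff_recurrence n s ρ (k + 1)
    push_cast at this ⊢
    linear_combination this

theorem gegenbauerSeries_sq_mul (n : ℕ) (s ρ : A) :
    gegenbauerSeries n s ρ ^ 2 * gegenbauerQuadratic s ρ ^ n = 1 := by
  have : IsAddTorsionFree A := .of_module_rat A
  apply derivative.ext
  · apply (isUnit_gegenbauerQuadratic s ρ).mul_left_cancel
    rw [mul_derivation_sq_mul_pow, derivative_one, derivative_gegenbauerQuadratic]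
    linear_combination 2 * gegenbauerSeries n s ρ * gegenbauerQuadratic s ρ ^ n *
      gegenbauerQuadratic_mul_derivative n s ρ
  · simp [gegenbauerSeries, gegenbauerQuadratic, gegenbauerCoeff]

end Formal

section Poisson

variable {A : Type*} [CommRing A] [Algebra ℚ A]

/-- The Poisson kernel `(1 - ρ w²) / (1 - 2 s w + ρ w²) ^ (n / 2)` as a formal power
series in `w`. -/
noncomputable def poissonSeries (n : ℕ) (s ρ : A) : A⟦X⟧ :=
  gegenbauerSeries n s ρ - X ^ 2 * (C ρ * gegenbauerSeries n s ρ)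

theorem map_poissonSeries {B : Type*} [CommRing B] [Algebra ℚ B] (φ : A →+* B) (n : ℕ) (s ρ : A) :
    map φ (poissonSeries n s ρ) = poissonSeries n (φ s) (φ ρ) := by
  have hG : map φ (gegenbauerSeries n s ρ) = gegenbauerSeries n (φ s) (φ ρ) := by
    ext k
    simp [gegenbauerSeries, map_gegenbauerCoeff]
  simp [poissonSeries, hG]

theorem coeff_poissonSeries_add_two (n : ℕ) (s ρ : A) (k : ℕ) :
    coeff (k + 2) (poissonSeries n s ρ) =
      gegenbauerCoeff n s ρ (k + 2) - ρ * gegenbauerCoeff n s ρ k := by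
  simp [poissonSeries, gegenbauerSeries, coeff_X_pow_mul]

theorem coeff_poissonSeries_of_lt_two (n : ℕ) (s ρ : A) {k : ℕ} (hk : k < 2) :
    coeff k (poissonSeries n s ρ) = gegenbauerCoeff n s ρ k := by
  simp [poissonSeries, gegenbauerSeries, coeff_X_pow_mul', hk]

end Poisson

section CoeffDerivation

variable {R A : Type*} [CommRing R] [CommRing A] [Algebra R A]

/-- The extension of a derivation to power series, acting on the coefficients. -/
noncomputable def coeffDerivation (D : Derivation R A A) : Derivation R A⟦X⟧ A⟦X⟧ :=
  Derivation.mk'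
    { toFun := fun F => mk fun k => D (coeff k F)
      map_add' := fun F G => by ext; simp
      map_smul' := fun r F => by ext; simp }
    fun F G => by
      ext k
      rw [smul_eq_mul, smul_eq_mul, mul_comm G]
      simp [coeff_mul, Finset.sum_add_distrib, mul_comm (coeff _ G)]

theorem coeff_coeffDerivation (D : Derivation R A A) (F : A⟦X⟧) (k : ℕ) :
    coeff k (coeffDerivation D F) = D (coeff k F) := by
  simp [coeffDerivation]

theorem coeffDerivation_C (D : Derivation R A A) (a : A) :
    coeffDerivation D (C a) = C (D a) := by
  ext k
  rw [coeff_coeffDerivation, coeff_C, coeff_C, apply_ite D, map_zero]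

theorem coeffDerivation_X (D : Derivation R A A) : coeffDerivation D (X : A⟦X⟧) = 0 := by
  ext k
  rw [coeff_coeffDerivation, coeff_X, apply_ite D, map_zero, D.map_one_eq_zero, ite_self, map_zero]

end CoeffDerivation

end PowerSeries

section FormalPoisson

variable {R B ι : Type*} [CommRing R] [CommRing B] [Algebra R B] [Fintype ι]
  {D : ι → Derivation R B B}

theorem mul_sum_derivation_derivation {c : ι → B} {τ q g : B} (hunit : IsUnit q)
    (hDg : ∀ i, q * D i g = -(Fintype.card ι * c i * g)) (hDq : ∀ i, D i q = 2 * c i)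
    (hDc : ∀ i, D i (c i) = τ) (hcc : ∑ i, c i ^ 2 = τ * q) :
    q * ∑ i, D i (D i g) = 2 * Fintype.card ι * τ * g := by
  set n := Fintype.card ι with hn
  have hDDg (i : ι) : q ^ 2 * D i (D i g) = n * (n + 2) * g * c i ^ 2 - n * τ * (q * g) := by
    have h := congr_arg (D i) (hDg i)
    simp only [Derivation.leibniz, map_neg, Derivation.map_natCast, hDq, hDc, smul_eq_mul] at h
    linear_combination q * h - (n + 2) * c i * hDg i
  apply hunit.mul_left_cancel
  calc q * (q * ∑ i, D i (D i g)) = ∑ i, q ^ 2 * D i (D i g) := by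
        rw [← mul_assoc, ← sq, Finset.mul_sum]
    _ = n * (n + 2) * g * (∑ i, c i ^ 2) - n * (n * τ * (q * g)) := by
        simp only [hDDg, Finset.sum_sub_distrib, Finset.mul_sum, Finset.sum_const,
          Finset.card_univ, nsmul_eq_mul, ← hn]
    _ = q * (2 * n * τ * g) := by rw [hcc]; ring

variable [DecidableEq ι] {x y : ι → B}

theorem derivation_sum_sq (hx : ∀ i j, D i (x j) = if i = j then 1 else 0) (i : ι) :
    D i (∑ j, x j ^ 2) = 2 * x i := by
  simp [Derivation.leibniz_pow, hx]

theorem sum_derivation_derivation_sum_sq_mul (hx : ∀ i j, D i (x j) = if i = j then 1 else 0)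
    (g : B) :
    ∑ i, D i (D i ((∑ j, x j ^ 2) * g)) =
      (∑ j, x j ^ 2) * ∑ i, D i (D i g) + 4 * ∑ i, x i * D i g + 2 * Fintype.card ι * g := by
  have h2 (i : ι) : D i 2 = 0 := mod_cast (D i).map_natCast 2
  have hterm (i : ι) : D i (D i ((∑ j, x j ^ 2) * g)) =
      (∑ j, x j ^ 2) * D i (D i g) + 4 * (x i * D i g) + 2 * g := by
    simp only [Derivation.leibniz, map_add, derivation_sum_sq hx, hx, h2, smul_eq_mul, if_true]
    ring
  simp only [hterm, Finset.sum_add_distrib, Finset.mul_sum, Finset.sum_const, Finset.card_univ,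
    nsmul_eq_mul]
  ring

variable [IsAddTorsionFree B] {t g q : B}

theorem sum_derivation_derivation_poissonKernel
    (hx : ∀ i j, D i (x j) = if i = j then 1 else 0) (hy : ∀ i j, D i (y j) = 0)
    (ht : ∀ i, D i t = 0) (hsq : ∑ i, y i ^ 2 = 1) (hunit : IsUnit q)
    (hq : q = 1 - 2 * (∑ i, y i * x i) * t + (∑ i, x i ^ 2) * t ^ 2)
    (hg : g ^ 2 * q ^ Fintype.card ι = 1) :
    ∑ i, D i (D i (g - t ^ 2 * ((∑ j, x j ^ 2) * g))) = 0 := by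
  set n := Fintype.card ι
  set c : ι → B := fun i => x i * t ^ 2 - y i * t with hc
  have hDs (i : ι) : D i (∑ j, y j * x j) = y i := by simp [hx, hy]
  have hDt (i : ι) : D i (t ^ 2) = 0 := by simp [Derivation.leibniz_pow, ht]
  have h2 (i : ι) : D i 2 = 0 := mod_cast (D i).map_natCast 2
  have hDq (i : ι) : D i q = 2 * c i := by
    simp only [hq, map_add, map_sub, Derivation.leibniz, Derivation.map_one_eq_zero, smul_eq_mul,
      derivation_sum_sq hx, hDs, hDt, ht, h2, hc]
    ring
  have hDg (i : ι) : q * D i g = -(n * c i * g) := by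
    apply nsmul_right_injective two_ne_zero
    simp only [nsmul_eq_mul, Nat.cast_ofNat]
    linear_combination two_mul_mul_derivation_of_sq_mul_pow_eq_one (D i) hg - n * g * hDq i
  have hcc : ∑ i, c i ^ 2 = t ^ 2 * q := by
    have hterm (i : ι) : c i ^ 2 = t ^ 4 * x i ^ 2 - 2 * t ^ 3 * (y i * x i) + t ^ 2 * y i ^ 2 := by
      ring
    simp only [hterm, Finset.sum_add_distrib, Finset.sum_sub_distrib, ← Finset.mul_sum, hsq, hq]
    ring
  have hxc : ∑ i, x i * c i = (∑ i, x i ^ 2) * t ^ 2 - (∑ i, y i * x i) * t := by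
    simp only [Finset.sum_mul, ← Finset.sum_sub_distrib]
    exact Finset.sum_congr rfl fun i _ => by ring
  have hΔg : q * ∑ i, D i (D i g) = 2 * n * t ^ 2 * g :=
    mul_sum_derivation_derivation hunit hDg hDq (by simp [hc, hx, hy, ht, hDt]) hcc
  have hxDg : q * ∑ i, x i * D i g = -(n * g * ∑ i, x i * c i) := by
    simp only [Finset.mul_sum, ← Finset.sum_neg_distrib]
    exact Finset.sum_congr rfl fun i _ => by linear_combination x i * hDg i
  apply hunit.mul_left_cancel
  simp only [map_sub, Derivation.leibniz (D _) (t ^ 2), hDt, smul_eq_mul, mul_zero, add_zero,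
    Finset.sum_sub_distrib, ← Finset.mul_sum, sum_derivation_derivation_sum_sq_mul hx]
  rw [hxc] at hxDg
  linear_combination (1 - t ^ 2 * ∑ i, x i ^ 2) * hΔg - 4 * t ^ 2 * hxDg - 2 * n * t ^ 2 * g * hq

end FormalPoisson

section Zonal

open MvPolynomial

theorem isHomogeneous_gegenbauerCoeff {σ R : Type*} [CommRing R] [Algebra ℚ R]
    {s ρ : MvPolynomial σ R} (hs : s.IsHomogeneous 1) (hρ : ρ.IsHomogeneous 2) (n : ℕ) :
    ∀ k, (gegenbauerCoeff n s ρ k).IsHomogeneous k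
  | 0 => isHomogeneous_one _ _
  | 1 => by
    rw [gegenbauerCoeff, ← map_natCast C]
    exact hs.C_mul _
  | k + 2 => by
    have h₁ := (hs.mul (isHomogeneous_gegenbauerCoeff hs hρ n (k + 1))).C_mul (2 * k + 2 + n)
    have h₀ := (hρ.mul (isHomogeneous_gegenbauerCoeff hs hρ n k)).C_mul (k + n)
    rw [show 1 + (k + 1) = k + 2 by omega] at h₁
    rw [add_comm 2 k] at h₀
    simp only [map_add, map_mul, map_natCast, map_ofNat, ← mul_assoc] at h₁ h₀
    rw [gegenbauerCoeff, ← algebraMap_smul R, smul_eq_C_mul]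
    exact (h₁.sub h₀).C_mul _

variable {n : ℕ}

/-- The linear form `⟨y, ·⟩` as a polynomial. -/
noncomputable def linearFormPoly (y : EucSpace n) : MvPolynomial (Fin n) ℝ :=
  ∑ i, C (y i) * X i

variable (n) in
/-- The square of the Euclidean norm as a polynomial. -/
noncomputable def normSqPoly : MvPolynomial (Fin n) ℝ := ∑ i, X i ^ 2

theorem eval_linearFormPoly (y x : EucSpace n) :
    eval (fun i => x i) (linearFormPoly y) = ⟪y, x⟫_ℝ := by
  simp [linearFormPoly, PiLp.inner_apply, mul_comm]

theorem eval_normSqPoly (x : EucSpace n) : eval (fun i => x i) (normSqPoly n) = ‖x‖ ^ 2 := by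
  simp [normSqPoly, EuclideanSpace.norm_sq_eq]

theorem isHomogeneous_linearFormPoly (y : EucSpace n) : (linearFormPoly y).IsHomogeneous 1 :=
  .sum _ _ _ fun i _ => (isHomogeneous_X ℝ i).C_mul _

theorem isHomogeneous_normSqPoly : (normSqPoly n).IsHomogeneous 2 :=
  .sum _ _ _ fun i _ => by simpa using (isHomogeneous_X ℝ i).pow 2

theorem polyLaplacian_apply (f : MvPolynomial (Fin n) ℝ) :
    polyLaplacian n f = ∑ i, pderiv i (pderiv i f) := by
  simp [polyLaplacian]

theorem isHomogeneous_coeff_poissonSeries (y : EucSpace n) (k : ℕ) :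
    (PowerSeries.coeff k (poissonSeries n (linearFormPoly y) (normSqPoly n))).IsHomogeneous k := by
  have hg (k : ℕ) := isHomogeneous_gegenbauerCoeff (isHomogeneous_linearFormPoly y)
    isHomogeneous_normSqPoly n k
  rcases lt_or_ge k 2 with hk | hk
  · rw [coeff_poissonSeries_of_lt_two _ _ _ hk]
    exact hg k
  · obtain ⟨k, rfl⟩ := Nat.exists_eq_add_of_le' hk
    rw [coeff_poissonSeries_add_two]
    exact (hg _).sub (add_comm 2 k ▸ isHomogeneous_normSqPoly.mul (hg k))

theorem polyLaplacian_coeff_poissonSeries {y : EucSpace n} (hy : ‖y‖ = 1) (k : ℕ) :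
    polyLaplacian n (PowerSeries.coeff k (poissonSeries n (linearFormPoly y) (normSqPoly n))) =
      0 := by
  set s := linearFormPoly y
  have : IsAddTorsionFree (PowerSeries (MvPolynomial (Fin n) ℝ)) := .of_module_rat _
  have hsq : ∑ i, y i ^ 2 = 1 := by rw [← EuclideanSpace.real_norm_sq_eq, hy, one_pow]
  have hP : poissonSeries n s (normSqPoly n) =
      gegenbauerSeries n s (normSqPoly n) - PowerSeries.X ^ 2 *
        ((∑ i, PowerSeries.C (X i) ^ 2) * gegenbauerSeries n s (normSqPoly n)) := by
    simp only [poissonSeries, normSqPoly, map_sum, map_pow]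
  have h := sum_derivation_derivation_poissonKernel
    (D := fun i : Fin n => coeffDerivation (pderiv (R := ℝ) i)) (t := PowerSeries.X)
    (x := fun i => PowerSeries.C (X i)) (y := fun i => PowerSeries.C (C (y i)))
    (q := gegenbauerQuadratic s (normSqPoly n)) (g := gegenbauerSeries n s (normSqPoly n))
    (fun i j => by
      rw [coeffDerivation_C, pderiv_X, Pi.single_apply, apply_ite PowerSeries.C]
      simp [eq_comm])
    (fun i j => by rw [coeffDerivation_C, pderiv_C, map_zero])
    (fun i => coeffDerivation_X _) (by simp only [← map_pow, ← map_sum, hsq, map_one])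
    (isUnit_gegenbauerQuadratic _ _) (by simp [gegenbauerQuadratic, s, linearFormPoly, normSqPoly])
    (by rw [Fintype.card_fin, gegenbauerSeries_sq_mul])
  rw [← hP] at h
  simpa only [polyLaplacian_apply, map_sum, coeff_coeffDerivation, map_zero] using
    congr_arg (PowerSeries.coeff k) h

/-- The zonal harmonic of degree `k` with pole `y`, the coefficient of `wᵏ` in the Poisson kernel
`(1 - |x|² w²) / (1 - 2 ⟨y, x⟩ w + |x|² w²) ^ (n / 2)`. -/
noncomputable def zonalHarmonic {y : EucSpace n} (hy : ‖y‖ = 1) (k : ℕ) : harmonicSpace n k :=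
  ⟨PowerSeries.coeff k (poissonSeries n (linearFormPoly y) (normSqPoly n)),
    isHomogeneous_coeff_poissonSeries y k, polyLaplacian_coeff_poissonSeries hy k⟩

theorem harmonicEval_zonalHarmonic {y : EucSpace n} (hy : ‖y‖ = 1) (k : ℕ) (x : EucSpace n) :
    harmonicEval (zonalHarmonic hy k) x =
      PowerSeries.coeff k (poissonSeries n ⟪y, x⟫_ℝ (‖x‖ ^ 2)) := by
  rw [harmonicEval, zonalHarmonic, ← eval_linearFormPoly, ← eval_normSqPoly, ← map_poissonSeries,
    PowerSeries.coeff_map]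

end Zonal

section Stein

open MvPolynomial

theorem pderiv_pderiv_comm {σ R : Type*} [CommRing R] (i j : σ) (f : MvPolynomial σ R) :
    pderiv i (pderiv j f) = pderiv j (pderiv i f) := by
  classical
  have h : ⁅pderiv (R := R) i, pderiv j⁆ = 0 := derivation_ext fun k => by
    rw [Derivation.commutator_apply, pderiv_X, pderiv_X, Pi.single_apply, Pi.single_apply]
    split_ifs <;> simp
  rw [← sub_eq_zero, ← Derivation.commutator_apply, h, Derivation.zero_apply]

theorem polyLaplacian_pderiv_eq_zero {n : ℕ} {p : MvPolynomial (Fin n) ℝ}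
    (hΔ : polyLaplacian n p = 0) (i : Fin n) : polyLaplacian n (pderiv i p) = 0 := by
  rw [← map_zero (pderiv i), ← hΔ, polyLaplacian_apply, polyLaplacian_apply, map_sum]
  exact Finset.sum_congr rfl fun j _ => by rw [pderiv_pderiv_comm j i, pderiv_pderiv_comm j i]

/-- The product `n (n + 2) ⋯ (n + 2 k - 2)`, the Gaussian mean of `|x|²ᵏ` on `ℝⁿ`. -/
def radialMoment (n k : ℕ) : ℝ := ∏ j ∈ Finset.range k, (n + 2 * j : ℝ)

/-- A linear functional on polynomials for which multiplication by `xᵢ` is adjoint to `∂ᵢ`, as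
Gaussian integration by parts (Stein's identity) asserts for the integral against
`exp (-|x|² / 2)`. -/
def IsSteinFunctional {n : ℕ} (E : MvPolynomial (Fin n) ℝ →ₗ[ℝ] ℝ) : Prop :=
  ∀ i f, E (X i * f) = E (pderiv i f)

namespace IsSteinFunctional

variable {n : ℕ} {E : MvPolynomial (Fin n) ℝ →ₗ[ℝ] ℝ} {f p : MvPolynomial (Fin n) ℝ} {j k : ℕ}

theorem natCast_mul_map_mul (hE : IsSteinFunctional E) (hp : p.IsHomogeneous k)
    (hΔ : polyLaplacian n p = 0) (f : MvPolynomial (Fin n) ℝ) :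
    k * E (f * p) = ∑ i, E (pderiv i f * pderiv i p) := by
  calc k * E (f * p) = E (f * ∑ i, X i * pderiv i p) := by
        rw [hp.sum_X_mul_pderiv, mul_smul_comm, map_nsmul, nsmul_eq_mul]
    _ = ∑ i, E (X i * (f * pderiv i p)) := by simp only [Finset.mul_sum, map_sum, mul_left_comm]
    _ = E (f * polyLaplacian n p) + ∑ i, E (pderiv i f * pderiv i p) := by
        simp only [hE _ _, Derivation.leibniz, smul_eq_mul, map_add, Finset.sum_add_distrib,
          polyLaplacian_apply, Finset.mul_sum, map_sum, mul_comm (pderiv _ p)]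
    _ = ∑ i, E (pderiv i f * pderiv i p) := by rw [hΔ, mul_zero, map_zero, zero_add]

theorem map_mul_eq_zero (hE : IsSteinFunctional E) (hjk : j < k) (hf : f.IsHomogeneous j)
    (hp : p.IsHomogeneous k) (hΔ : polyLaplacian n p = 0) : E (f * p) = 0 := by
  induction j generalizing k f p with
  | zero =>
    rw [← totalDegree_zero_iff_isHomogeneous, totalDegree_eq_zero_iff_eq_C] at hf
    have h := hE.natCast_mul_map_mul hp hΔ f
    rw [hf] at h ⊢
    simp only [pderiv_C, zero_mul, map_zero, Finset.sum_const_zero] at h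
    exact (mul_eq_zero.1 h).resolve_left (mod_cast hjk.ne')
  | succ j ih =>
    have h := hE.natCast_mul_map_mul hp hΔ f
    rw [Finset.sum_eq_zero fun i _ => ih (by omega) hf.pderiv hp.pderiv
      (polyLaplacian_pderiv_eq_zero hΔ i)] at h
    exact (mul_eq_zero.1 h).resolve_left (mod_cast (Nat.zero_lt_of_lt hjk).ne')

theorem map_normSqPoly_mul (hE : IsSteinFunctional E) (hf : f.IsHomogeneous k) :
    E (normSqPoly n * f) = (n + k) * E f := by
  have hterm (i : Fin n) : E (X i ^ 2 * f) = E f + E (X i * pderiv i f) := by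
    rw [sq, mul_assoc, hE, Derivation.leibniz, pderiv_X_self, smul_eq_mul, smul_eq_mul, mul_one,
      map_add, add_comm]
  rw [normSqPoly, Finset.sum_mul, map_sum]
  simp only [hterm, Finset.sum_add_distrib]
  rw [← map_sum E fun i => X i * pderiv i f, hf.sum_X_mul_pderiv, map_nsmul]
  simp only [Finset.sum_const, Finset.card_univ, Fintype.card_fin, nsmul_eq_mul]
  ring

theorem map_normSqPoly_pow (hE : IsSteinFunctional E) (k : ℕ) :
    E (normSqPoly n ^ k) = radialMoment n k * E 1 := by
  induction k with
  | zero => simp [radialMoment]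
  | succ k ih =>
    rw [pow_succ', hE.map_normSqPoly_mul (isHomogeneous_normSqPoly.pow k), ih, radialMoment,
      radialMoment, Finset.prod_range_succ]
    push_cast
    ring

theorem map_linearFormPoly_mul (hE : IsSteinFunctional E) (y : EucSpace n)
    (f : MvPolynomial (Fin n) ℝ) : E (linearFormPoly y * f) = ∑ i, y i * E (pderiv i f) := by
  simp only [linearFormPoly, Finset.sum_mul, map_sum, C_mul', smul_mul_assoc, map_smul, hE _ _,
    smul_eq_mul]

theorem natCast_succ_mul_map_gegenbauerCoeff_mul (hE : IsSteinFunctional E) (y : EucSpace n)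
    (hp : p.IsHomogeneous (k + 1)) (hΔ : polyLaplacian n p = 0) :
    (k + 1) * E (gegenbauerCoeff n (linearFormPoly y) (normSqPoly n) (k + 1) * p) =
      (n + 2 * k) * ∑ i, y i *
        E (gegenbauerCoeff n (linearFormPoly y) (normSqPoly n) k * pderiv i p) := by
  have hg (k : ℕ) := isHomogeneous_gegenbauerCoeff (isHomogeneous_linearFormPoly y)
    isHomogeneous_normSqPoly n k
  set g := gegenbauerCoeff n (linearFormPoly y) (normSqPoly n) with hgdef
  have hnat (c : ℕ) (q : MvPolynomial (Fin n) ℝ) : E (c * q) = c * E q := by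
    rw [← nsmul_eq_mul, map_nsmul, nsmul_eq_mul]
  have hρ (j : ℕ) (hj : j < k + 1) : E (normSqPoly n * (g j * p)) = 0 := by
    rw [hE.map_normSqPoly_mul ((hg j).mul hp), hE.map_mul_eq_zero hj (hg j) hp hΔ, mul_zero]
  have hs : E (linearFormPoly y * (g k * p)) = ∑ i, y i * E (g k * pderiv i p) := by
    rw [hE.map_linearFormPoly_mul]
    refine Finset.sum_congr rfl fun i _ => ?_
    rw [Derivation.leibniz, map_add, smul_eq_mul, smul_eq_mul, mul_comm p,
      hE.map_mul_eq_zero (by omega) (hg k).pderiv hp hΔ, add_zero]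
  rw [← hs]
  cases k with
  | zero => simp [hgdef, gegenbauerCoeff, mul_assoc, hnat]
  | succ k =>
    have hrec : ((k + 2 : ℕ) : MvPolynomial (Fin n) ℝ) * (g (k + 2) * p) =
        ((2 * k + 2 + n : ℕ) : MvPolynomial (Fin n) ℝ) * (linearFormPoly y * (g (k + 1) * p)) -
          ((k + n : ℕ) : MvPolynomial (Fin n) ℝ) * (normSqPoly n * (g k * p)) := by
      push_cast
      linear_combination p * gegenbauerCoeff_recurrence n (linearFormPoly y) (normSqPoly n) k
    have hE_rec := congr_arg E hrec
    simp only [map_sub, hnat, hρ k (by omega), mul_zero, sub_zero] at hE_rec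
    push_cast at hE_rec ⊢
    linear_combination hE_rec

theorem map_gegenbauerCoeff_mul (hE : IsSteinFunctional E) (y : EucSpace n)
    (hp : p.IsHomogeneous k) (hΔ : polyLaplacian n p = 0) :
    E (gegenbauerCoeff n (linearFormPoly y) (normSqPoly n) k * p) =
      radialMoment n k * eval (fun i => y i) p * E 1 := by
  induction k generalizing p with
  | zero =>
    rw [← totalDegree_zero_iff_isHomogeneous, totalDegree_eq_zero_iff_eq_C] at hp
    have h : p = coeff 0 p • 1 := by rw [smul_eq_C_mul, mul_one]; exact hp
    rw [h]
    simp [gegenbauerCoeff, radialMoment]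
  | succ k ih =>
    have hk : (k + 1 : ℝ) ≠ 0 := by positivity
    have heuler : ∑ i, y i * eval (fun i => y i) (pderiv i p) =
        (k + 1) * eval (fun i => y i) p := by
      simpa using congr_arg (eval fun i => y i) hp.sum_X_mul_pderiv
    apply mul_left_cancel₀ hk
    rw [hE.natCast_succ_mul_map_gegenbauerCoeff_mul y hp hΔ]
    simp only [ih hp.pderiv (polyLaplacian_pderiv_eq_zero hΔ _)]
    calc (n + 2 * k) * ∑ i, y i * (radialMoment n k * eval (fun i => y i) (pderiv i p) * E 1)
        = (n + 2 * k) * radialMoment n k * E 1 *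
            ∑ i, y i * eval (fun i => y i) (pderiv i p) := by
          simp only [Finset.mul_sum]
          exact Finset.sum_congr rfl fun i _ => by ring
      _ = (k + 1) * (radialMoment n (k + 1) * eval (fun i => y i) p * E 1) := by
          rw [heuler, radialMoment, radialMoment, Finset.prod_range_succ]
          ring

theorem map_zonalHarmonic_mul (hE : IsSteinFunctional E) {y : EucSpace n} (hy : ‖y‖ = 1)
    (p : harmonicSpace n k) :
    E ((zonalHarmonic hy k : MvPolynomial (Fin n) ℝ) * p) =
      radialMoment n k * harmonicEval p y * E 1 := by
  obtain ⟨p, hp, hΔ⟩ := p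
  change p.IsHomogeneous k at hp
  change polyLaplacian n p = 0 at hΔ
  have hg (k : ℕ) := isHomogeneous_gegenbauerCoeff (isHomogeneous_linearFormPoly y)
    isHomogeneous_normSqPoly n k
  change E (PowerSeries.coeff k (poissonSeries n (linearFormPoly y) (normSqPoly n)) * p) = _
  rw [harmonicEval, ← hE.map_gegenbauerCoeff_mul y hp hΔ]
  rcases lt_or_ge k 2 with hk | hk
  · rw [coeff_poissonSeries_of_lt_two _ _ _ hk]
  · obtain ⟨j, rfl⟩ := Nat.exists_eq_add_of_le' hk
    rw [coeff_poissonSeries_add_two, sub_mul, map_sub, mul_assoc,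
      hE.map_normSqPoly_mul ((hg j).mul hp), hE.map_mul_eq_zero (by omega) (hg j) hp hΔ, mul_zero,
      sub_zero]

end IsSteinFunctional

end Stein

section Gaussian

open MvPolynomial

theorem eval_smul_of_isHomogeneous {σ R : Type*} [CommSemiring R] {f : MvPolynomial σ R} {d : ℕ}
    (hf : f.IsHomogeneous d) (r : R) (x : σ → R) : eval (r • x) f = r ^ d * eval x f := by
  rw [eval_eq, eval_eq, Finset.mul_sum]
  refine Finset.sum_congr rfl fun m hm => ?_
  have hdeg : ∑ i ∈ m.support, m i = d := by
    simpa [Finsupp.weight_apply, Finsupp.sum] using hf (mem_support_iff.1 hm)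
  simp only [Pi.smul_apply, smul_eq_mul, mul_pow, Finset.prod_mul_distrib,
    Finset.prod_pow_eq_pow_sum, hdeg, mul_left_comm]

theorem integral_eq_integral_toSphere_mul {E : Type*} [NormedAddCommGroup E] [NormedSpace ℝ E]
    [FiniteDimensional ℝ E] [Nontrivial E] [MeasurableSpace E] [BorelSpace E] (μ : Measure E)
    [μ.IsAddHaarMeasure] {F : E → ℝ} {G : sphere (0 : E) 1 → ℝ} {H : ℝ → ℝ}
    (hF : ∀ (θ : sphere (0 : E) 1) (r : ℝ), 0 < r → F (r • (θ : E)) = G θ * H r) :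
    ∫ x, F x ∂μ = (∫ θ, G θ ∂μ.toSphere) *
      ∫ r : Ioi (0 : ℝ), H r ∂(Measure.volumeIoiPow (Module.finrank ℝ E - 1)) := by
  have h := μ.measurePreserving_homeomorphUnitSphereProd.integral_comp
    (Homeomorph.measurableEmbedding _) fun z => G z.1 * H z.2
  rw [integral_prod_mul (fun θ => G θ) fun r : Ioi (0 : ℝ) => H r] at h
  calc ∫ x, F x ∂μ = ∫ x : ({0}ᶜ : Set E), F x ∂(μ.comap Subtype.val) := by
        rw [integral_subtype_comap (measurableSet_singleton _).compl F, restrict_compl_singleton]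
    _ = ∫ x, G (homeomorphUnitSphereProd E x).1 * H (homeomorphUnitSphereProd E x).2
          ∂(μ.comap Subtype.val) := by
        refine integral_congr_ae (.of_forall fun x => ?_)
        have hx : ‖(x : E)‖ ≠ 0 := norm_ne_zero_iff.2 x.2
        refine Eq.trans ?_ (hF _ _ (homeomorphUnitSphereProd E x).2.2)
        simp [smul_smul, hx]
    _ = _ := h

variable {n : ℕ}

theorem continuous_eval_euclidean (f : MvPolynomial (Fin n) ℝ) :
    Continuous fun x : EucSpace n => eval (fun i => x i) f :=
  (MvPolynomial.continuous_eval f).comp (by fun_prop)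

theorem hasLineDerivAt_eval (f : MvPolynomial (Fin n) ℝ) (i : Fin n) (x : EucSpace n) :
    HasLineDerivAt ℝ (fun x : EucSpace n => eval (fun i => x i) f)
      (eval (fun i => x i) (pderiv i f)) x (EuclideanSpace.single i 1) := by
  unfold HasLineDerivAt
  induction f using MvPolynomial.induction_on with
  | C a => simpa using hasDerivAt_const (0 : ℝ) a
  | add p q hp hq => simpa using! hp.add hq
  | mul_X p j hp =>
    have hX : HasDerivAt (fun t : ℝ => (x + t • EuclideanSpace.single i (1 : ℝ)) j)
        (eval (fun i => x i) (pderiv i (X j))) 0 := by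
      classical
      rw [pderiv_X, Pi.single_apply]
      rcases eq_or_ne i j with rfl | hij
      · simpa using (hasDerivAt_id (0 : ℝ)).const_add (x i)
      · simpa [hij, hij.symm] using hasDerivAt_const (0 : ℝ) (x j)
    simpa [mul_comm, add_comm] using! hp.mul hX

theorem hasLineDerivAt_gaussian (i : Fin n) (x : EucSpace n) :
    HasLineDerivAt ℝ (fun x : EucSpace n => Real.exp (-‖x‖ ^ 2 / 2))
      (-(x i) * Real.exp (-‖x‖ ^ 2 / 2)) x (EuclideanSpace.single i 1) := by
  classical
  have h := hasLineDerivAt_eval (normSqPoly n) i x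
  have hρ : pderiv i (normSqPoly n) = 2 * X i := by
    simp [normSqPoly, pderiv_X, Pi.single_apply]
  simp only [eval_normSqPoly, hρ] at h
  unfold HasLineDerivAt at h ⊢
  refine (h.neg.div_const 2).exp.congr_deriv ?_
  simp only [Pi.neg_apply, zero_smul, add_zero, map_mul, eval_ofNat, eval_X, neg_mul]
  ring

variable [NeZero n]

variable (n) in
theorem integrable_norm_pow_mul_gaussian (d : ℕ) :
    Integrable fun x : EucSpace n => ‖x‖ ^ d * Real.exp (-‖x‖ ^ 2 / 2) := by
  rw [integrable_fun_norm_addHaar volume (f := fun r : ℝ => r ^ d * Real.exp (-r ^ 2 / 2))]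
  refine (integrableOn_rpow_mul_exp_neg_mul_sq (b := 1 / 2) (by norm_num)
    (s := (Module.finrank ℝ (EucSpace n) - 1 + d : ℕ))
    (neg_one_lt_zero.trans_le (Nat.cast_nonneg _))).congr_fun (fun r _ => ?_) measurableSet_Ioi
  simp only [Real.rpow_natCast, smul_eq_mul, pow_add, mul_assoc]
  ring_nf

theorem integrable_eval_mul_gaussian (f : MvPolynomial (Fin n) ℝ) :
    Integrable fun x : EucSpace n => eval (fun i => x i) f * Real.exp (-‖x‖ ^ 2 / 2) := by
  induction f using MvPolynomial.induction_on' with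
  | monomial m a =>
    refine ((integrable_norm_pow_mul_gaussian n (∑ i, m i)).const_mul |a|).mono'
      ((continuous_eval_euclidean _).mul (by fun_prop)).aestronglyMeasurable
      (.of_forall fun x => ?_)
    rw [norm_mul, Real.norm_of_nonneg (Real.exp_pos _).le, ← mul_assoc, eval_monomial, norm_mul,
      Real.norm_eq_abs, Finsupp.prod_fintype _ _ (by simp), norm_prod, ← Finset.prod_pow_eq_pow_sum]
    gcongr with i
    rw [norm_pow]
    gcongr
    exact PiLp.norm_apply_le x i
  | add p q hp hq =>
    simp only [map_add, add_mul]
    exact hp.add hq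

variable (n) in
/-- Integration of polynomials against the Gaussian weight `exp (-|x|² / 2)`. -/
noncomputable def gaussianFunctional : MvPolynomial (Fin n) ℝ →ₗ[ℝ] ℝ where
  toFun f := ∫ x : EucSpace n, eval (fun i => x i) f * Real.exp (-‖x‖ ^ 2 / 2)
  map_add' f g := by
    simp only [map_add, add_mul]
    exact integral_add (integrable_eval_mul_gaussian f) (integrable_eval_mul_gaussian g)
  map_smul' c f := by
    simp only [smul_eval, mul_assoc, RingHom.id_apply, smul_eq_mul]
    exact integral_const_mul _ _

theorem gaussianFunctional_apply (f : MvPolynomial (Fin n) ℝ) :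
    gaussianFunctional n f =
      ∫ x : EucSpace n, eval (fun i => x i) f * Real.exp (-‖x‖ ^ 2 / 2) := rfl

variable (n) in
theorem isSteinFunctional_gaussianFunctional : IsSteinFunctional (gaussianFunctional n) := by
  intro i f
  have hneg (x : EucSpace n) : eval (fun i => x i) f * (-(x i) * Real.exp (-‖x‖ ^ 2 / 2)) =
      -(eval (fun i => x i) (X i * f) * Real.exp (-‖x‖ ^ 2 / 2)) := by
    rw [eval_mul, eval_X]
    ring
  have hparts := integral_bilinear_hasLineDerivAt_right_eq_neg_left_of_integrable
    (μ := (volume : Measure (EucSpace n))) (B := ContinuousLinearMap.mul ℝ ℝ)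
    (by simpa using integrable_eval_mul_gaussian (pderiv i f))
    (by simpa only [ContinuousLinearMap.mul_apply', hneg] using!
      (integrable_eval_mul_gaussian (X i * f)).neg)
    (by simpa using integrable_eval_mul_gaussian f)
    (fun x _ => hasLineDerivAt_eval f i x) (fun x _ => hasLineDerivAt_gaussian i x)
  simpa only [ContinuousLinearMap.mul_apply', hneg, integral_neg, neg_inj] using! hparts

variable (n) in
theorem gaussianFunctional_one_pos : 0 < gaussianFunctional n 1 := by
  have h := integrable_eval_mul_gaussian (1 : MvPolynomial (Fin n) ℝ)
  rw [gaussianFunctional_apply]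
  simp only [map_one, one_mul] at h ⊢
  exact integral_exp_pos h

variable (n) in
theorem radialMoment_pos (k : ℕ) : 0 < radialMoment n k := by
  have : (0 : ℝ) < n := mod_cast NeZero.pos n
  exact Finset.prod_pos fun j _ => by positivity

theorem gaussianFunctional_eq_integral_toSphere_mul {f : MvPolynomial (Fin n) ℝ} {d : ℕ}
    (hf : f.IsHomogeneous d) :
    gaussianFunctional n f =
      (∫ θ : UnitSphere n, eval (fun i => (θ : EucSpace n) i) f
        ∂(volume : Measure (EucSpace n)).toSphere) *
      ∫ r : Ioi (0 : ℝ), (r : ℝ) ^ d * Real.exp (-(r : ℝ) ^ 2 / 2)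
        ∂(Measure.volumeIoiPow (Module.finrank ℝ (EucSpace n) - 1)) := by
  refine integral_eq_integral_toSphere_mul volume
    (H := fun r => r ^ d * Real.exp (-r ^ 2 / 2)) fun θ r hr => ?_
  have h := eval_smul_of_isHomogeneous hf r fun i => (θ : EucSpace n) i
  rw [norm_smul, norm_eq_of_mem_sphere, Real.norm_of_nonneg hr.le, mul_one, ← mul_assoc,
    mul_comm _ (r ^ d), ← h]
  rfl

theorem average_toSphere_eval_eq_div {f : MvPolynomial (Fin n) ℝ} {k : ℕ}
    (hf : f.IsHomogeneous (2 * k)) :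
    (⨍ θ : UnitSphere n, eval (fun i => (θ : EucSpace n) i) f
      ∂(volume : Measure (EucSpace n)).toSphere) =
      gaussianFunctional n f / gaussianFunctional n (normSqPoly n ^ k) := by
  have hρ := gaussianFunctional_eq_integral_toSphere_mul
    ((isHomogeneous_normSqPoly (n := n)).pow k)
  have hpos : gaussianFunctional n (normSqPoly n ^ k) ≠ 0 := by
    rw [(isSteinFunctional_gaussianFunctional n).map_normSqPoly_pow]
    exact (mul_pos (radialMoment_pos n k) (gaussianFunctional_one_pos n)).ne'
  rw [gaussianFunctional_eq_integral_toSphere_mul hf]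
  simp only [map_pow, eval_normSqPoly, norm_eq_of_mem_sphere, one_pow, integral_const, smul_eq_mul,
    mul_one] at hρ
  rw [hρ] at hpos ⊢
  rw [mul_div_mul_right _ _ (right_ne_zero_of_mul hpos), average_eq, smul_eq_mul, inv_mul_eq_div]

theorem average_zonalHarmonic_mul {y : EucSpace n} (hy : ‖y‖ = 1) {k : ℕ}
    (p : harmonicSpace n k) :
    (⨍ θ : UnitSphere n, harmonicEval (zonalHarmonic hy k) θ * harmonicEval p θ
      ∂(volume : Measure (EucSpace n)).toSphere) = harmonicEval p y := by
  have hE := isSteinFunctional_gaussianFunctional n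
  have hdeg : ((zonalHarmonic hy k : MvPolynomial (Fin n) ℝ) * p).IsHomogeneous (2 * k) := by
    rw [two_mul]
    exact IsHomogeneous.mul (zonalHarmonic hy k).2.1 p.2.1
  simp only [harmonicEval, ← map_mul]
  rw [average_toSphere_eval_eq_div hdeg, hE.map_zonalHarmonic_mul hy, hE.map_normSqPoly_pow,
    harmonicEval]
  field_simp [(radialMoment_pos n k).ne', (gaussianFunctional_one_pos n).ne']

end Gaussian

section Addition

variable {n k : ℕ}

theorem harmonicEval_sum_smul {ι : Type*} (s : Finset ι) (c : ι → ℝ) (p : ι → harmonicSpace n k)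
    (x : EucSpace n) :
    harmonicEval (∑ i ∈ s, c i • p i) x = ∑ i ∈ s, c i * harmonicEval (p i) x := by
  simp [harmonicEval, MvPolynomial.smul_eval]

theorem harmonicEval_smul (p : harmonicSpace n k) (r : ℝ) (x : EucSpace n) :
    harmonicEval p (r • x) = r ^ k * harmonicEval p x :=
  eval_smul_of_isHomogeneous p.2.1 r _

theorem norm_pow_mul_harmonicEval_normalize (p : harmonicSpace n k) (x : EucSpace n) :
    ‖x‖ ^ k * harmonicEval p (‖x‖⁻¹ • x) = harmonicEval p x := by
  rw [← harmonicEval_smul]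
  rcases eq_or_ne x 0 with rfl | hx
  · simp
  · rw [smul_inv_smul₀ (norm_ne_zero_iff.2 hx)]

theorem integrable_toSphere_harmonicEval_mul (p q : harmonicSpace n k) :
    Integrable (fun θ : UnitSphere n => harmonicEval p θ * harmonicEval q θ)
      (volume : Measure (EucSpace n)).toSphere :=
  (((continuous_harmonicEval p).comp continuous_subtype_val).mul
    ((continuous_harmonicEval q).comp continuous_subtype_val)).integrable_of_hasCompactSupport
      (.of_compactSpace _)

namespace IsOrthonormalHarmonicBasis

variable {Y : ∀ k : ℕ, Module.Basis (Fin (harmonicDim n k)) ℝ (harmonicSpace n k)}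

theorem average_mul_eq_repr (hY : IsOrthonormalHarmonicBasis n Y) (p : harmonicSpace n k)
    (m : Fin (harmonicDim n k)) :
    (⨍ θ : UnitSphere n, harmonicEval p θ * harmonicEval (Y k m) θ
      ∂(volume : Measure (EucSpace n)).toSphere) = (Y k).repr p m := by
  have hp (x : EucSpace n) : harmonicEval p x = ∑ l, (Y k).repr p l * harmonicEval (Y k l) x := by
    rw [← harmonicEval_sum_smul, (Y k).sum_repr]
  have horth (l : Fin (harmonicDim n k)) := hY k l m
  simp only [average_eq, smul_eq_mul] at horth ⊢
  simp only [hp, Finset.sum_mul, mul_assoc]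
  rw [integral_finsetSum _ fun l _ => (integrable_toSphere_harmonicEval_mul _ _).const_mul _]
  simp only [integral_const_mul, Finset.mul_sum, mul_left_comm _ ((Y k).repr p _), horth, mul_ite,
    mul_one, mul_zero, Finset.sum_ite_eq', Finset.mem_univ, if_true]

variable [NeZero n]

theorem sum_mul_eq_zonalHarmonic (hY : IsOrthonormalHarmonicBasis n Y) {y : EucSpace n}
    (hy : ‖y‖ = 1) (k : ℕ) (x : EucSpace n) :
    ∑ l, harmonicEval (Y k l) y * harmonicEval (Y k l) x = harmonicEval (zonalHarmonic hy k) x := by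
  rw [← (Y k).sum_repr (zonalHarmonic hy k), harmonicEval_sum_smul]
  refine Finset.sum_congr rfl fun l _ => ?_
  rw [← hY.average_mul_eq_repr, average_zonalHarmonic_mul]

theorem sum_mul_eq_coeff_poissonSeries (hY : IsOrthonormalHarmonicBasis n Y) {y : EucSpace n}
    (hy : ‖y‖ = 1) (k : ℕ) (x : EucSpace n) :
    ∑ l, harmonicEval (Y k l) y * harmonicEval (Y k l) x =
      PowerSeries.coeff k (poissonSeries n ⟪y, x⟫_ℝ (‖x‖ ^ 2)) := by
  rw [hY.sum_mul_eq_zonalHarmonic hy, harmonicEval_zonalHarmonic]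

theorem coeff_poissonSeries_one_one (hY : IsOrthonormalHarmonicBasis n Y) (k : ℕ) :
    PowerSeries.coeff k (poissonSeries n (1 : ℝ) 1) = harmonicDim n k := by
  have hsum (θ : UnitSphere n) : ∑ l, harmonicEval (Y k l) θ * harmonicEval (Y k l) θ =
      PowerSeries.coeff k (poissonSeries n (1 : ℝ) 1) := by
    rw [hY.sum_mul_eq_coeff_poissonSeries (norm_eq_of_mem_sphere θ), real_inner_self_eq_norm_sq,
      norm_eq_of_mem_sphere, one_pow]
  have hσ : NeZero (volume : Measure (EucSpace n)).toSphere := ⟨Measure.toSphere_ne_zero _⟩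
  calc PowerSeries.coeff k (poissonSeries n (1 : ℝ) 1)
      = ⨍ θ : UnitSphere n, ∑ l, harmonicEval (Y k l) θ * harmonicEval (Y k l) θ
          ∂(volume : Measure (EucSpace n)).toSphere := by
        simp only [hsum, average_const]
    _ = ∑ l, ⨍ θ : UnitSphere n, harmonicEval (Y k l) θ * harmonicEval (Y k l) θ
          ∂(volume : Measure (EucSpace n)).toSphere := by
        simp only [average_eq]
        rw [integral_finsetSum _ fun l _ => integrable_toSphere_harmonicEval_mul _ _,
          Finset.smul_sum]
    _ = harmonicDim n k := by simp [hY k]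

theorem sum_sq_eq_harmonicDim (hY : IsOrthonormalHarmonicBasis n Y) {y : EucSpace n}
    (hy : ‖y‖ = 1) (k : ℕ) : ∑ l, harmonicEval (Y k l) y ^ 2 = harmonicDim n k := by
  simp only [sq]
  rw [hY.sum_mul_eq_coeff_poissonSeries hy, real_inner_self_eq_norm_sq, hy, one_pow,
    hY.coeff_poissonSeries_one_one]

theorem harmonicEval_sq_le (hY : IsOrthonormalHarmonicBasis n Y) (l : Fin (harmonicDim n k))
    (x : EucSpace n) : harmonicEval (Y k l) x ^ 2 ≤ harmonicDim n k * (‖x‖ ^ k) ^ 2 := by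
  have hunit {y : EucSpace n} (hy : ‖y‖ = 1) : harmonicEval (Y k l) y ^ 2 ≤ harmonicDim n k :=
    (Finset.single_le_sum (f := fun l => harmonicEval (Y k l) y ^ 2) (fun _ _ => sq_nonneg _)
      (Finset.mem_univ l)).trans_eq (hY.sum_sq_eq_harmonicDim hy k)
  obtain ⟨y, hy, hxy⟩ : ∃ y : EucSpace n, ‖y‖ = 1 ∧ x = ‖x‖ • y := by
    rcases eq_or_ne x 0 with rfl | hx
    · obtain ⟨y, hy⟩ := exists_norm_eq (EucSpace n) zero_le_one
      exact ⟨y, hy, by simp⟩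
    · exact ⟨‖x‖⁻¹ • x, norm_smul_inv_norm hx, (smul_inv_smul₀ (norm_ne_zero_iff.2 hx) x).symm⟩
  rw [hxy, harmonicEval_smul, norm_smul, hy, mul_one, norm_norm, mul_pow, mul_comm]
  gcongr
  exact hunit hy

theorem abs_harmonicEval_mul_le (hY : IsOrthonormalHarmonicBasis n Y) (l : Fin (harmonicDim n k))
    (x y : EucSpace n) :
    |harmonicEval (Y k l) x * harmonicEval (Y k l) y| ≤ harmonicDim n k * (‖x‖ ^ k * ‖y‖ ^ k) := by
  refine abs_le_of_sq_le_sq ?_ (by positivity)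
  calc (harmonicEval (Y k l) x * harmonicEval (Y k l) y) ^ 2
      = harmonicEval (Y k l) x ^ 2 * harmonicEval (Y k l) y ^ 2 := mul_pow _ _ _
    _ ≤ (harmonicDim n k * (‖x‖ ^ k) ^ 2) * (harmonicDim n k * (‖y‖ ^ k) ^ 2) := by
        gcongr <;> exact hY.harmonicEval_sq_le l _
    _ = (harmonicDim n k * (‖x‖ ^ k * ‖y‖ ^ k)) ^ 2 := by ring

end IsOrthonormalHarmonicBasis

end Addition

section PowerSeriesSum

open PowerSeries

/-- The formal power series `F` converges at `w` with sum `a`. -/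
def HasPowerSeriesSum (F : ℂ⟦X⟧) (w a : ℂ) : Prop := HasSum (fun k => coeff k F * w ^ k) a

namespace HasPowerSeriesSum

variable {F G : ℂ⟦X⟧} {w a b : ℂ}

theorem const (c w : ℂ) : HasPowerSeriesSum (C c) w c := by
  have h := hasSum_single (f := fun k => coeff k (C c) * w ^ k) 0 fun k hk => by
    rw [coeff_C, if_neg hk, zero_mul]
  simpa [HasPowerSeriesSum] using h

theorem one (w : ℂ) : HasPowerSeriesSum 1 w 1 := by simpa using const 1 w

theorem X (w : ℂ) : HasPowerSeriesSum PowerSeries.X w w := by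
  have h := hasSum_single (f := fun k => coeff k (PowerSeries.X : ℂ⟦X⟧) * w ^ k) 1 fun k hk => by
    rw [coeff_X, if_neg hk, zero_mul]
  simpa [HasPowerSeriesSum] using h

theorem add (hF : HasPowerSeriesSum F w a) (hG : HasPowerSeriesSum G w b) :
    HasPowerSeriesSum (F + G) w (a + b) := by
  simpa only [HasPowerSeriesSum, map_add, add_mul] using HasSum.add hF hG

theorem sub (hF : HasPowerSeriesSum F w a) (hG : HasPowerSeriesSum G w b) :
    HasPowerSeriesSum (F - G) w (a - b) := by
  simpa only [HasPowerSeriesSum, map_sub, sub_mul] using HasSum.sub hF hG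

theorem mul (hF : HasPowerSeriesSum F w a) (hG : HasPowerSeriesSum G w b) :
    HasPowerSeriesSum (F * G) w (a * b) := by
  have hF' := Summable.norm (HasSum.summable hF)
  have hG' := Summable.norm (HasSum.summable hG)
  have hcoeff (k : ℕ) : ∑ p ∈ Finset.HasAntidiagonal.antidiagonal k,
      coeff p.1 F * w ^ p.1 * (coeff p.2 G * w ^ p.2) = coeff k (F * G) * w ^ k := by
    rw [coeff_mul, Finset.sum_mul]
    refine Finset.sum_congr rfl fun p hp => ?_
    rw [← Finset.HasAntidiagonal.mem_antidiagonal.1 hp, pow_add]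
    ring
  have hsum := (summable_norm_sum_mul_antidiagonal_of_summable_norm hF' hG').of_norm.hasSum
  rw [← tsum_mul_tsum_eq_tsum_sum_antidiagonal_of_summable_norm hF' hG', HasSum.tsum_eq hF,
    HasSum.tsum_eq hG] at hsum
  simpa only [HasPowerSeriesSum, hcoeff] using hsum

theorem pow (hF : HasPowerSeriesSum F w a) (m : ℕ) : HasPowerSeriesSum (F ^ m) w (a ^ m) := by
  induction m with
  | zero => simpa using one w
  | succ m ih => simpa only [pow_succ] using ih.mul hF

theorem eq_of_eventually {f : ℂ → ℂ} (hF : ∀ᶠ w in nhds 0, HasPowerSeriesSum F w (f w))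
    (hG : ∀ᶠ w in nhds 0, HasPowerSeriesSum G w (f w)) : F = G := by
  have hseries {F : ℂ⟦X⟧} (hF : ∀ᶠ w in nhds 0, HasPowerSeriesSum F w (f w)) :
      HasFPowerSeriesAt f (FormalMultilinearSeries.ofScalars ℂ fun k => coeff k F) 0 := by
    rw [hasFPowerSeriesAt_iff]
    filter_upwards [hF] with w hw
    simpa [FormalMultilinearSeries.coeff_ofScalars, mul_comm, HasPowerSeriesSum] using hw
  ext k
  simpa [FormalMultilinearSeries.coeff_ofScalars] using
    congr_arg (FormalMultilinearSeries.coeff · k)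
      ((hseries hF).eq_formalMultilinearSeries (hseries hG))

end HasPowerSeriesSum

theorem exists_hasPowerSeriesSum {f : ℂ → ℂ} {r : ℝ} (hf : DifferentiableOn ℂ f (ball 0 r)) :
    ∃ F : ℂ⟦X⟧, ∀ w ∈ ball (0 : ℂ) r, HasPowerSeriesSum F w (f w) := by
  refine ⟨mk fun k => (k.factorial : ℂ)⁻¹ * iteratedDeriv k f 0, fun w hw => ?_⟩
  have h := Complex.hasSum_taylorSeries_on_ball hf hw
  simpa only [HasPowerSeriesSum, coeff_mk, sub_zero, smul_eq_mul, mul_assoc,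
    mul_comm (w ^ _)] using h

theorem hasPowerSeriesSum_gegenbauerQuadratic (s ρ w : ℂ) :
    HasPowerSeriesSum (gegenbauerQuadratic s ρ) w (1 - 2 * s * w + ρ * w ^ 2) := by
  have h := ((HasPowerSeriesSum.one w).sub ((HasPowerSeriesSum.const (2 * s) w).mul (.X w))).add
    ((HasPowerSeriesSum.const ρ w).mul ((HasPowerSeriesSum.X w).pow 2))
  rwa [map_mul, map_ofNat] at h

theorem hasPowerSeriesSum_gegenbauerSeries (n : ℕ) {s ρ w : ℂ} {r : ℝ}
    (hQ : ∀ w ∈ ball (0 : ℂ) r, 1 - 2 * s * w + ρ * w ^ 2 ∈ Complex.slitPlane)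
    (hw : w ∈ ball 0 r) :
    HasPowerSeriesSum (gegenbauerSeries n s ρ) w
      (((1 - 2 * s * w + ρ * w ^ 2) ^ (1 / 2 : ℂ))⁻¹ ^ n) := by
  set f : ℂ → ℂ := fun w => ((1 - 2 * s * w + ρ * w ^ 2) ^ (1 / 2 : ℂ))⁻¹ ^ n with hf
  have hball : ball (0 : ℂ) r ∈ nhds 0 := ball_mem_nhds 0 (pos_of_mem_ball hw)
  have hdiff : DifferentiableOn ℂ f (ball 0 r) := by
    refine ((DifferentiableOn.cpow_const (by fun_prop) hQ).inv fun w hw => ?_).pow n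
    simpa [Complex.cpow_eq_zero_iff] using Complex.slitPlane_ne_zero (hQ w hw)
  have hfQ (w : ℂ) (hw : w ∈ ball 0 r) : f w ^ 2 * (1 - 2 * s * w + ρ * w ^ 2) ^ n = 1 := by
    have hne := Complex.slitPlane_ne_zero (hQ w hw)
    have hsq : ((1 - 2 * s * w + ρ * w ^ 2) ^ (1 / 2 : ℂ)) ^ 2 = 1 - 2 * s * w + ρ * w ^ 2 := by
      rw [one_div]
      exact_mod_cast Complex.cpow_nat_inv_pow _ two_ne_zero
    rw [hf, ← pow_mul, mul_comm n, pow_mul, inv_pow, hsq, inv_pow,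
      inv_mul_cancel₀ (pow_ne_zero n hne)]
  obtain ⟨F, hF⟩ := exists_hasPowerSeriesSum hdiff
  have hFQ : F ^ 2 * gegenbauerQuadratic s ρ ^ n = 1 := by
    refine HasPowerSeriesSum.eq_of_eventually (f := 1) ?_ (.of_forall fun w => .one w)
    filter_upwards [hball] with w hw
    rw [Pi.one_apply, ← hfQ w hw]
    exact ((hF w hw).pow 2).mul ((hasPowerSeriesSum_gegenbauerQuadratic s ρ w).pow n)
  have hsq : F ^ 2 = gegenbauerSeries n s ρ ^ 2 :=
    ((isUnit_gegenbauerQuadratic s ρ).pow n).mul_right_cancel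
      (hFQ.trans (gegenbauerSeries_sq_mul n s ρ).symm)
  have hF0 : constantCoeff F = 1 := by
    have h := HasSum.unique (hF 0 (mem_of_mem_nhds hball))
      (hasSum_single 0 fun k hk => by rw [zero_pow hk, mul_zero])
    simpa [hf] using h.symm
  obtain rfl | rfl := sq_eq_sq_iff_eq_or_eq_neg.1 hsq
  · exact hF w hw
  · norm_num [gegenbauerSeries, gegenbauerCoeff] at hF0

theorem hasPowerSeriesSum_poissonSeries (n : ℕ) {s ρ w : ℂ} {r : ℝ}
    (hQ : ∀ w ∈ ball (0 : ℂ) r, 1 - 2 * s * w + ρ * w ^ 2 ∈ Complex.slitPlane)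
    (hw : w ∈ ball 0 r) :
    HasPowerSeriesSum (poissonSeries n s ρ) w
      ((1 - ρ * w ^ 2) * ((1 - 2 * s * w + ρ * w ^ 2) ^ (1 / 2 : ℂ))⁻¹ ^ n) := by
  have hG := hasPowerSeriesSum_gegenbauerSeries n hQ hw
  generalize ((1 - 2 * s * w + ρ * w ^ 2) ^ (1 / 2 : ℂ))⁻¹ ^ n = a at hG ⊢
  rw [show (1 - ρ * w ^ 2) * a = a - w ^ 2 * (ρ * a) by ring]
  exact hG.sub (((HasPowerSeriesSum.X w).pow 2).mul ((HasPowerSeriesSum.const ρ w).mul hG))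

variable {n : ℕ} {θ x : EucSpace n}

theorem one_sub_two_mul_inner_mul_add_mem_slitPlane (hθ : ‖θ‖ = 1) {w : ℂ}
    (hw : ‖w‖ * ‖x‖ < 1) :
    1 - 2 * (⟪θ, x⟫_ℝ : ℂ) * w + (‖x‖ : ℂ) ^ 2 * w ^ 2 ∈ Complex.slitPlane := by
  rcases eq_or_ne w 0 with rfl | hw0
  · simp
  · have hx : ‖x‖ < ‖w⁻¹‖ := by
      rwa [norm_inv, ← mul_one ‖w‖⁻¹, lt_inv_mul_iff₀ (norm_pos_iff.2 hw0)]
    simpa using aronszajnRoot_slitPlane hθ hx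

theorem hasSum_coeff_poissonSeries_inner (hθ : ‖θ‖ = 1) {w : ℂ} (hw : ‖w‖ * ‖x‖ < 1) :
    HasSum (fun k => ((coeff k (poissonSeries n ⟪θ, x⟫_ℝ (‖x‖ ^ 2)) : ℝ) : ℂ) * w ^ k)
      ((1 - (‖x‖ : ℂ) ^ 2 * w ^ 2) *
        ((1 - 2 * (⟪θ, x⟫_ℝ : ℂ) * w + (‖x‖ : ℂ) ^ 2 * w ^ 2) ^ (1 / 2 : ℂ))⁻¹ ^ n) := by
  obtain ⟨r, hr, hwr⟩ : ∃ r, r * ‖x‖ < 1 ∧ ‖w‖ < r :=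
    (((continuous_id.mul continuous_const).tendsto' ‖w‖ _ rfl).eventually_lt_const hw |>.filter_mono
      nhdsWithin_le_nhds |>.and (self_mem_nhdsWithin (s := Ioi ‖w‖))).exists
  have hQ (z : ℂ) (hz : z ∈ ball 0 r) :
      1 - 2 * (⟪θ, x⟫_ℝ : ℂ) * z + (‖x‖ : ℂ) ^ 2 * z ^ 2 ∈ Complex.slitPlane :=
    one_sub_two_mul_inner_mul_add_mem_slitPlane hθ
      ((mul_le_mul_of_nonneg_right (mem_ball_zero_iff.1 hz).le (norm_nonneg x)).trans_lt hr)
  have hmap : PowerSeries.map Complex.ofRealHom (poissonSeries n ⟪θ, x⟫_ℝ (‖x‖ ^ 2)) =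
      poissonSeries n (⟪θ, x⟫_ℝ : ℂ) ((‖x‖ : ℂ) ^ 2) := by
    simp [map_poissonSeries]
  simpa only [HasPowerSeriesSum, ← hmap, coeff_map] using!
    hasPowerSeriesSum_poissonSeries n hQ (mem_ball_zero_iff.2 hwr)

end PowerSeriesSum

section HarmonicDimension

variable {n : ℕ} [NeZero n]
  {Y : ∀ k : ℕ, Module.Basis (Fin (harmonicDim n k)) ℝ (harmonicSpace n k)}

namespace IsOrthonormalHarmonicBasis

theorem summable_harmonicDim_mul_pow (hY : IsOrthonormalHarmonicBasis n Y) {q : ℝ} (hq₀ : 0 ≤ q)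
    (hq₁ : q < 1) : Summable fun k => (harmonicDim n k : ℝ) * q ^ k := by
  have he : ‖EuclideanSpace.single (0 : Fin n) (1 : ℝ)‖ = 1 := by simp
  have h := hasSum_coeff_poissonSeries_inner (w := q) he (x := EuclideanSpace.single 0 1)
    (by simpa [abs_of_nonneg hq₀] using hq₁)
  rw [real_inner_self_eq_norm_sq, he, one_pow] at h
  simp only [hY.coeff_poissonSeries_one_one] at h
  exact_mod_cast h.summable

theorem summable_harmonicDim_sq_mul_pow (hY : IsOrthonormalHarmonicBasis n Y) {q : ℝ}
    (hq₀ : 0 ≤ q) (hq₁ : q < 1) : Summable fun k => (harmonicDim n k : ℝ) ^ 2 * q ^ k := by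
  have hs := hY.summable_harmonicDim_mul_pow (Real.sqrt_nonneg q)
    ((Real.sqrt_lt_sqrt hq₀ hq₁).trans_eq Real.sqrt_one)
  have hsq (k : ℕ) : (harmonicDim n k : ℝ) ^ 2 * q ^ k =
      harmonicDim n k * √q ^ k * (harmonicDim n k * √q ^ k) := by
    rw [← pow_two (_ * _), mul_pow, ← pow_mul, mul_comm k, pow_mul, Real.sq_sqrt hq₀]
  have hnonneg (k : ℕ) : 0 ≤ (harmonicDim n k : ℝ) * √q ^ k := by positivity
  simpa only [hsq] using!
    (hs.mul_of_nonneg hs hnonneg hnonneg).comp_injective (i := fun k => (k, k)) fun j k hjk => by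
      simpa using hjk

theorem summable_sigma_pow_mul_harmonicDim (hY : IsOrthonormalHarmonicBasis n Y) {q : ℝ}
    (hq₀ : 0 ≤ q) (hq₁ : q < 1) :
    Summable fun a : Σ k : ℕ, Fin (harmonicDim n k) => q ^ a.1 * harmonicDim n a.1 := by
  rw [summable_sigma_of_nonneg fun a => by positivity]
  refine ⟨fun k => Summable.of_finite, (hY.summable_harmonicDim_sq_mul_pow hq₀ hq₁).congr ?_⟩
  intro k
  simp only [tsum_fintype, Finset.sum_const, Finset.card_univ, Fintype.card_fin, nsmul_eq_mul]
  ring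

end IsOrthonormalHarmonicBasis

end HarmonicDimension

section SignedMeasureIntegral

variable {X : Type*} [MeasurableSpace X] (μ : SignedMeasure X)

theorem isFiniteMeasure_variation : IsFiniteMeasure μ.variation := by
  rw [← SignedMeasure.totalVariation_eq_variation]
  infer_instance

section NormedSpace

variable {E F : Type*} [NormedAddCommGroup E] [NormedAddCommGroup F]

theorem integrable_signedMeasure_of_bound {f : X → E} (hf : AEStronglyMeasurable f μ.variation)
    {C : ℝ} (hC : ∀ᵐ x ∂μ.variation, ‖f x‖ ≤ C) : VectorMeasure.Integrable μ f :=
  have := isFiniteMeasure_variation μ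
  Integrable.of_bound hf C hC

variable {μ} in
theorem integrable_signedMeasure_iff_jordanDecomposition {f : X → E} :
    VectorMeasure.Integrable μ f ↔ Integrable f μ.toJordanDecomposition.posPart ∧
      Integrable f μ.toJordanDecomposition.negPart := by
  rw [VectorMeasure.Integrable, ← SignedMeasure.totalVariation_eq_variation,
    SignedMeasure.totalVariation, integrable_add_measure]

variable [NormedSpace ℝ E] [NormedSpace ℝ F]

variable {μ} in
theorem integral_signedMeasure_eq_sub {f : X → E} (hf : VectorMeasure.Integrable μ f) :
    ∫ᵛ x, f x ∂<•μ = ∫ x, f x ∂μ.toJordanDecomposition.posPart -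
      ∫ x, f x ∂μ.toJordanDecomposition.negPart := by
  obtain ⟨hpos, hneg⟩ := integrable_signedMeasure_iff_jordanDecomposition.1 hf
  conv_lhs => rw [← SignedMeasure.toSignedMeasure_toJordanDecomposition μ]
  rw [JordanDecomposition.toSignedMeasure, VectorMeasure.integral_sub_vectorMeasure
    (by simpa [VectorMeasure.Integrable] using hpos)
    (by simpa [VectorMeasure.Integrable] using hneg),
    VectorMeasure.integral_toSignedMeasure, VectorMeasure.integral_toSignedMeasure]

variable {μ} in
theorem integral_signedMeasure_clm_apply [CompleteSpace E] [CompleteSpace F] (L : E →L[ℝ] F)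
    {f : X → E} (hf : VectorMeasure.Integrable μ f) :
    ∫ᵛ x, L (f x) ∂<•μ = L (∫ᵛ x, f x ∂<•μ) := by
  obtain ⟨hpos, hneg⟩ := integrable_signedMeasure_iff_jordanDecomposition.1 hf
  rw [integral_signedMeasure_eq_sub hf, integral_signedMeasure_eq_sub (L.integrable_comp hf),
    L.integral_comp_comm hpos, L.integral_comp_comm hneg, map_sub]

variable {μ} in
theorem hasSum_integral_signedMeasure_of_bound {ι : Type*} [Countable ι] {f : ι → X → E} {g : X → E}
    (hf : ∀ i, AEStronglyMeasurable (f i) μ.variation) {b : ι → ℝ}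
    (hfb : ∀ i, ∀ᵐ x ∂μ.variation, ‖f i x‖ ≤ b i) (hb : Summable b)
    (hfg : ∀ᵐ x ∂μ.variation, HasSum (fun i => f i x) (g x)) :
    HasSum (fun i => ∫ᵛ x, f i x ∂<•μ) (∫ᵛ x, g x ∂<•μ) :=
  have := isFiniteMeasure_variation μ
  VectorMeasure.hasSum_integral_of_dominated_convergence (fun i _ => b i) hf hfb
    (.of_forall fun _ => hb) (integrable_const _) hfg

end NormedSpace

theorem integral_complex_withDensity_bounded {g : X → ℝ} {f : X → ℂ} (hg : Measurable g) {C : ℝ}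
    (hC : ∀ x, ‖g x‖ ≤ C) (hf : Measurable f) {D : ℝ} (hD : ∀ x, ‖f x‖ ≤ D) :
    ∫ᵛ x, f x ∂<•(VectorMeasure.withDensity μ g (ContinuousLinearMap.lsmul ℝ ℝ)) =
      ∫ᵛ x, f x * g x ∂<•μ := by
  set ν := VectorMeasure.withDensity μ g (ContinuousLinearMap.lsmul ℝ ℝ)
  have hfν : VectorMeasure.Integrable ν f :=
    integrable_signedMeasure_of_bound ν hf.aestronglyMeasurable (.of_forall hD)
  have hfg : VectorMeasure.Integrable μ fun x => f x * g x := by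
    refine integrable_signedMeasure_of_bound μ (C := D * C) (by fun_prop) (.of_forall fun x => ?_)
    rw [norm_mul, Complex.norm_real]
    exact mul_le_mul (hD x) (hC x) (norm_nonneg _) ((norm_nonneg _).trans (hD x))
  have hpart (L : ℂ →L[ℝ] ℝ) (hL : ∀ z : ℂ, ‖L z‖ ≤ ‖z‖) (hLg : ∀ z (t : ℝ), L (z * t) = L z * t) :
      L (∫ᵛ x, f x ∂<•ν) = L (∫ᵛ x, f x * g x ∂<•μ) := by
    rw [← integral_signedMeasure_clm_apply L hfν, ← integral_signedMeasure_clm_apply L hfg,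
      integral_withDensity_bounded (f := fun x => L (f x)) μ hg hC
        (L.continuous.measurable.comp hf).stronglyMeasurable fun x => (hL _).trans (hD x)]
    simp only [hLg]
  exact Complex.ext (hpart Complex.reCLM Complex.abs_re_le_norm (by simp))
    (hpart Complex.imCLM Complex.abs_im_le_norm (by simp))

end SignedMeasureIntegral

section ComponentMeasure

theorem norm_indicator_le_abs {X E : Type*} [SeminormedAddCommGroup E] {s : Set X} {f : X → E}
    {D : ℝ} (hD : ∀ x ∈ s, ‖f x‖ ≤ D) (x : X) : ‖s.indicator f x‖ ≤ |D| := by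
  rw [norm_indicator_eq_indicator_norm]
  exact indicator_le' (fun x hx => (hD x hx).trans (le_abs_self D)) (fun _ _ => abs_nonneg D) x

variable {n k : ℕ} (μ : SignedMeasure (EucSpace n)) (p : harmonicSpace n k)

theorem integral_complex_componentMeasure {f : ℝ → ℂ} (hf : Measurable f) {D : ℝ}
    (hD : ∀ r, ‖f r‖ ≤ D) :
    ∫ᵛ r, f r ∂<•(componentMeasure μ p) =
      ∫ᵛ x, f ‖x‖ * harmonicEval p (‖x‖⁻¹ • x) ∂<•μ := by
  obtain ⟨C, hC⟩ := exists_bound_harmonicEval p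
  have hfn : Measurable fun x : EucSpace n => f ‖x‖ := by fun_prop
  rw [componentMeasure, VectorMeasure.integral_map measurable_norm hf.aestronglyMeasurable
    (integrable_signedMeasure_of_bound _ hfn.aestronglyMeasurable (.of_forall fun x => hD _))]
  exact integral_complex_withDensity_bounded μ (measurable_harmonicEval_normalize p) hC hfn
    fun x => hD _

theorem integrableOn_componentMeasure {s : Set ℝ} (hs : MeasurableSet s) {f : ℝ → ℂ}
    (hf : Measurable f) {D : ℝ} (hD : ∀ r ∈ s, ‖f r‖ ≤ D) :
    VectorMeasure.IntegrableOn (componentMeasure μ p) f s := by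
  rw [← VectorMeasure.integrable_indicator_iff hs]
  exact integrable_signedMeasure_of_bound _ (hf.indicator hs).aestronglyMeasurable
    (.of_forall (norm_indicator_le_abs hD))

variable {μ} in
theorem setIntegral_componentMeasure {s : Set ℝ} (hs : MeasurableSet s)
    (hμ : ∀ᵐ x ∂μ.variation, ‖x‖ ∈ s) {f : ℝ → ℂ} (hf : Measurable f) {D : ℝ}
    (hD : ∀ r ∈ s, ‖f r‖ ≤ D) :
    ∫ᵛ r in s, f r ∂<•(componentMeasure μ p) =
      ∫ᵛ x, f ‖x‖ * harmonicEval p (‖x‖⁻¹ • x) ∂<•μ := by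
  rw [← VectorMeasure.integral_indicator hs,
    integral_complex_componentMeasure μ p (hf.indicator hs)
      (norm_indicator_le_abs hD)]
  refine VectorMeasure.integral_congr_ae ?_
  filter_upwards [hμ] with x hx
  rw [indicator_of_mem hx]

end ComponentMeasure

section KleinDirac

namespace KDQ

variable {n : ℕ}

/-- The absolute value `|ζ|` of the point `ζθ` of the Klein-Dirac quadric. -/
noncomputable def norm : KDQ n → ℝ :=
  Quotient.lift (fun p : ℂ × UnitSphere n => ‖p.1‖) fun p q h => by
    rcases h with rfl | rfl
    · rfl
    · exact norm_neg q.1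

theorem continuous_norm : Continuous (norm (n := n)) :=
  Continuous.quotient_lift (s := kdqSetoid n) continuous_fst.norm _

theorem continuous_mk : Continuous fun p : ℂ × UnitSphere n => mk p.1 p.2 :=
  continuous_quotient_mk' (s := kdqSetoid n)

theorem mk_mem_closure_ball {R : ℝ} (hR : R ≠ 0) {ζ : ℂ} (hζ : ‖ζ‖ ≤ R) (θ : UnitSphere n) :
    mk ζ θ ∈ closure (ball n R) := by
  have hmk : Continuous fun ζ : ℂ => mk ζ θ := continuous_mk.comp (.prodMk_left θ)
  have hζR : ζ ∈ closure (Metric.ball (0 : ℂ) R) := by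
    rwa [closure_ball _ hR, mem_closedBall_zero_iff]
  exact map_mem_closure (f := fun ζ => mk ζ θ) hmk hζR
    fun w hw => ⟨w, θ, mem_ball_zero_iff.1 hw, rfl⟩

theorem exists_lt_norm_of_isCompact {R : ℝ} (hR : R ≠ 0) {K : Set (KDQ n)} (hK : IsCompact K)
    (hKR : K ⊆ (closure (ball n R))ᶜ) :
    ∃ R' : ℝ, R < R' ∧ ∀ (ζ : ℂ) (θ : UnitSphere n), mk ζ θ ∈ K → R' ≤ ‖ζ‖ := by
  rcases K.eq_empty_or_nonempty with rfl | hne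
  · exact ⟨R + 1, by linarith, fun _ _ h => h.elim⟩
  · obtain ⟨p, hp, hmin⟩ := hK.exists_isMinOn hne continuous_norm.continuousOn
    refine ⟨norm p, ?_, fun ζ θ h => hmin h⟩
    obtain ⟨⟨ζ, θ⟩, rfl⟩ := Quotient.exists_rep p
    by_contra! hle
    exact hKR hp (mk_mem_closure_ball hR hle θ)

end KDQ

end KleinDirac

section KernelExpansion

variable {n : ℕ}

theorem norm_sq_sub_sq_le_norm_sub (ζ : ℂ) (r : ℝ) :
    ‖ζ‖ ^ 2 - r ^ 2 ≤ ‖ζ ^ 2 - (r : ℂ) ^ 2‖ := by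
  have h := norm_sub_norm_le (ζ ^ 2) ((r : ℂ) ^ 2)
  rwa [norm_pow, norm_pow, Complex.norm_real, Real.norm_eq_abs, sq_abs] at h

theorem sq_sub_ofReal_sq_ne_zero {ζ : ℂ} {r : ℝ} (hr₀ : 0 ≤ r) (hr : r < ‖ζ‖) :
    ζ ^ 2 - (r : ℂ) ^ 2 ≠ 0 := by
  have hsq : r ^ 2 < ‖ζ‖ ^ 2 := pow_lt_pow_left₀ hr hr₀ two_ne_zero
  exact norm_pos_iff.1 ((sub_pos.2 hsq).trans_le (norm_sq_sub_sq_le_norm_sub ζ r))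

theorem norm_div_norm_sq_sub_sq_le {ζ : ℂ} {r R R' : ℝ} (hr₀ : 0 ≤ r) (hr : r ≤ R) (hR : R < R')
    (hζ : R' ≤ ‖ζ‖) : ‖ζ‖ / ‖ζ ^ 2 - (r : ℂ) ^ 2‖ ≤ (R' - R)⁻¹ := by
  have hpos : 0 < ‖ζ ^ 2 - (r : ℂ) ^ 2‖ :=
    norm_pos_iff.2 (sq_sub_ofReal_sq_ne_zero hr₀ (by linarith))
  rw [← one_div, div_le_div_iff₀ hpos (by linarith), one_mul]
  calc ‖ζ‖ * (R' - R) ≤ (‖ζ‖ + r) * (‖ζ‖ - r) := by gcongr; linarith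
    _ = ‖ζ‖ ^ 2 - r ^ 2 := by ring
    _ ≤ ‖ζ ^ 2 - (r : ℂ) ^ 2‖ := norm_sq_sub_sq_le_norm_sub ζ r

theorem huaAronszajnKernel_eq [NeZero n] {ζ : ℂ} (hζ : ζ ≠ 0) (θ x : EucSpace n) :
    huaAronszajnKernel n ζ θ x = ζ⁻¹ *
      ((1 - 2 * (⟪θ, x⟫_ℝ : ℂ) * ζ⁻¹ + (‖x‖ : ℂ) ^ 2 * ζ⁻¹ ^ 2) ^ (1 / 2 : ℂ))⁻¹ ^ n := by
  simp only [huaAronszajnKernel, aronszajnRoot, div_eq_mul_inv, mul_pow, mul_inv, inv_pow]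
  rw [← mul_assoc, pow_sub₀ ζ hζ (NeZero.one_le), pow_one, mul_comm (ζ ^ n),
    mul_inv_cancel_right₀ (pow_ne_zero n hζ)]

theorem measurable_huaAronszajnKernel (ζ : ℂ) (θ : EucSpace n) :
    Measurable (huaAronszajnKernel n ζ θ) := by
  unfold huaAronszajnKernel aronszajnRoot
  fun_prop

/-- The `(k, ℓ)` term of the expansion of the Hua-Aronszajn kernel into spherical harmonics,
indexed by pairs `a = (k, ℓ)`. -/
noncomputable def kernelTerm
    (Y : ∀ k : ℕ, Module.Basis (Fin (harmonicDim n k)) ℝ (harmonicSpace n k))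
    (ζ : ℂ) (θ x : EucSpace n) (a : Σ k : ℕ, Fin (harmonicDim n k)) : ℂ :=
  ζ ^ (-(a.1 : ℤ) + 1) * harmonicEval (Y a.1 a.2) θ *
    (harmonicEval (Y a.1 a.2) x / (ζ ^ 2 - (‖x‖ : ℂ) ^ 2))

variable {Y : ∀ k : ℕ, Module.Basis (Fin (harmonicDim n k)) ℝ (harmonicSpace n k)}

theorem measurable_kernelTerm (ζ : ℂ) (θ : EucSpace n) (a : Σ k : ℕ, Fin (harmonicDim n k)) :
    Measurable fun x => kernelTerm Y ζ θ x a := by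
  have := (continuous_harmonicEval (Y a.1 a.2)).measurable
  unfold kernelTerm
  fun_prop

namespace IsOrthonormalHarmonicBasis

variable [NeZero n] {ζ : ℂ} {θ x : EucSpace n} {R R' : ℝ}

theorem norm_kernelTerm_le (hY : IsOrthonormalHarmonicBasis n Y) (hθ : ‖θ‖ = 1) (hx : ‖x‖ ≤ R)
    (hR : R < R') (hζ : R' ≤ ‖ζ‖) (a : Σ k : ℕ, Fin (harmonicDim n k)) :
    ‖kernelTerm Y ζ θ x a‖ ≤ (R' - R)⁻¹ * ((R / R') ^ a.1 * harmonicDim n a.1) := by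
  obtain ⟨k, l⟩ := a
  have hR₀ : 0 ≤ R := (norm_nonneg x).trans hx
  have hR'₀ : 0 < R' := hR₀.trans_lt hR
  have hζ₀ : 0 < ‖ζ‖ := hR'₀.trans_le hζ
  calc ‖kernelTerm Y ζ θ x ⟨k, l⟩‖
      = ‖ζ‖ / ‖ζ ^ 2 - (‖x‖ : ℂ) ^ 2‖ *
          (|harmonicEval (Y k l) θ * harmonicEval (Y k l) x| / ‖ζ‖ ^ k) := by
        rw [kernelTerm, norm_mul, norm_mul, norm_div, norm_zpow, Complex.norm_real,
          Complex.norm_real, abs_mul, Real.norm_eq_abs, Real.norm_eq_abs, zpow_add₀ hζ₀.ne',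
          zpow_neg, zpow_natCast, zpow_one]
        ring
    _ ≤ (R' - R)⁻¹ * (harmonicDim n k * (‖θ‖ ^ k * ‖x‖ ^ k) / ‖ζ‖ ^ k) := by
        gcongr
        · exact norm_div_norm_sq_sub_sq_le (norm_nonneg x) hx hR hζ
        · exact hY.abs_harmonicEval_mul_le l θ x
    _ = (R' - R)⁻¹ * ((‖x‖ / ‖ζ‖) ^ k * harmonicDim n k) := by
        rw [hθ, one_pow, one_mul, div_pow]
        ring
    _ ≤ (R' - R)⁻¹ * ((R / R') ^ k * harmonicDim n k) := by
        have := sub_pos.2 hR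
        gcongr

theorem summable_kernelTerm_bound (hY : IsOrthonormalHarmonicBasis n Y) (hR₀ : 0 ≤ R)
    (hR : R < R') : Summable fun a : Σ k : ℕ, Fin (harmonicDim n k) =>
      (R' - R)⁻¹ * ((R / R') ^ a.1 * harmonicDim n a.1) :=
  (hY.summable_sigma_pow_mul_harmonicDim (div_nonneg hR₀ (hR₀.trans hR.le))
    ((div_lt_one (hR₀.trans_lt hR)).2 hR)).mul_left _

theorem sum_kernelTerm (hY : IsOrthonormalHarmonicBasis n Y) (hζ : ζ ≠ 0) (hθ : ‖θ‖ = 1) (k : ℕ) :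
    ∑ l, kernelTerm Y ζ θ x ⟨k, l⟩ = ζ / (ζ ^ 2 - (‖x‖ : ℂ) ^ 2) *
      (((PowerSeries.coeff k (poissonSeries n ⟪θ, x⟫_ℝ (‖x‖ ^ 2)) : ℝ) : ℂ) * ζ⁻¹ ^ k) := by
  rw [← hY.sum_mul_eq_coeff_poissonSeries hθ, Complex.ofReal_sum, Finset.sum_mul, Finset.mul_sum]
  refine Finset.sum_congr rfl fun l _ => ?_
  rw [kernelTerm, zpow_add₀ hζ, zpow_neg, zpow_natCast, zpow_one, Complex.ofReal_mul, inv_pow]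
  ring

theorem hasSum_kernelTerm (hY : IsOrthonormalHarmonicBasis n Y) (hθ : ‖θ‖ = 1)
    (hx : ‖x‖ < ‖ζ‖) : HasSum (kernelTerm Y ζ θ x) (huaAronszajnKernel n ζ θ x) := by
  have hζ : ζ ≠ 0 := norm_pos_iff.1 ((norm_nonneg x).trans_lt hx)
  have hne := sq_sub_ofReal_sq_ne_zero (norm_nonneg x) hx
  have hfactor : ζ / (ζ ^ 2 - (‖x‖ : ℂ) ^ 2) * (1 - (‖x‖ : ℂ) ^ 2 * ζ⁻¹ ^ 2) = ζ⁻¹ := by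
    field_simp
  have hw : ‖ζ⁻¹‖ * ‖x‖ < 1 := by
    rwa [norm_inv, inv_mul_lt_one₀ (norm_pos_iff.2 hζ)]
  have hsum : HasSum (fun k => ∑ l, kernelTerm Y ζ θ x ⟨k, l⟩) (huaAronszajnKernel n ζ θ x) := by
    have h := (hasSum_coeff_poissonSeries_inner hθ hw).mul_left (ζ / (ζ ^ 2 - (‖x‖ : ℂ) ^ 2))
    rw [← mul_assoc, hfactor, ← huaAronszajnKernel_eq hζ] at h
    exact h.congr_fun fun k => hY.sum_kernelTerm hζ hθ k
  refine hsum.sigma_of_hasSum (fun k => hasSum_fintype _) ?_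
  refine Summable.of_norm_bounded (hY.summable_kernelTerm_bound (norm_nonneg x) hx) fun a => ?_
  exact hY.norm_kernelTerm_le hθ le_rfl hx le_rfl a

theorem norm_huaAronszajnKernel_le (hY : IsOrthonormalHarmonicBasis n Y) (hθ : ‖θ‖ = 1)
    (hx : ‖x‖ ≤ R) (hζ : R < ‖ζ‖) :
    ‖huaAronszajnKernel n ζ θ x‖ ≤ ∑' a : Σ k : ℕ, Fin (harmonicDim n k),
      (‖ζ‖ - R)⁻¹ * ((R / ‖ζ‖) ^ a.1 * harmonicDim n a.1) := by
  rw [← (hY.hasSum_kernelTerm hθ (hx.trans_lt hζ)).tsum_eq]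
  exact tsum_of_norm_bounded
    (hY.summable_kernelTerm_bound ((norm_nonneg x).trans hx) hζ).hasSum
    fun a => hY.norm_kernelTerm_le hθ hx hζ le_rfl a

end IsOrthonormalHarmonicBasis

end KernelExpansion

section MomentSeries

variable {n : ℕ} {μ : SignedMeasure (EucSpace n)} {ζ : ℂ} {R : ℝ}

theorem continuousOn_pow_div_sq_sub_sq (hζ : R < ‖ζ‖) (k : ℕ) :
    ContinuousOn (fun r : ℝ => (r : ℂ) ^ k / (ζ ^ 2 - (r : ℂ) ^ 2)) (Icc 0 R) :=
  .div (by fun_prop) (by fun_prop) fun _ hr =>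
    sq_sub_ofReal_sq_ne_zero hr.1 (hr.2.trans_lt hζ)

theorem integrableOn_componentMeasure_pow_div (hζ : R < ‖ζ‖) {k j : ℕ} (p : harmonicSpace n k) :
    VectorMeasure.IntegrableOn (componentMeasure μ p)
      (fun r : ℝ => (r : ℂ) ^ j / (ζ ^ 2 - (r : ℂ) ^ 2)) (Icc 0 R) := by
  obtain ⟨D, hD⟩ := isCompact_Icc.exists_bound_of_continuousOn (continuousOn_pow_div_sq_sub_sq hζ j)
  exact integrableOn_componentMeasure μ p measurableSet_Icc (by fun_prop) hD

theorem setIntegral_componentMeasure_pow_div (hμ : ∀ᵐ x ∂μ.variation, ‖x‖ ≤ R) (hζ : R < ‖ζ‖)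
    {k : ℕ} (p : harmonicSpace n k) :
    ∫ᵛ r in Icc 0 R, (r : ℂ) ^ k / (ζ ^ 2 - (r : ℂ) ^ 2) ∂<•(componentMeasure μ p) =
      ∫ᵛ x, (harmonicEval p x / (ζ ^ 2 - (‖x‖ : ℂ) ^ 2) : ℂ) ∂<•μ := by
  obtain ⟨D, hD⟩ := isCompact_Icc.exists_bound_of_continuousOn (continuousOn_pow_div_sq_sub_sq hζ k)
  rw [setIntegral_componentMeasure p measurableSet_Icc
    (hμ.mono fun x hx => ⟨norm_nonneg x, hx⟩) (by fun_prop) hD]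
  congr 1 with x
  rw [← norm_pow_mul_harmonicEval_normalize p x, Complex.ofReal_mul, Complex.ofReal_pow]
  ring

theorem integrable_harmonicEval_div_sq_sub_sq (hμ : ∀ᵐ x ∂μ.variation, ‖x‖ ≤ R) (hζ : R < ‖ζ‖)
    {k : ℕ} (p : harmonicSpace n k) : VectorMeasure.Integrable μ
      fun x => (harmonicEval p x / (ζ ^ 2 - (‖x‖ : ℂ) ^ 2) : ℂ) := by
  have hmeas := (continuous_harmonicEval p).measurable
  have hcont : ContinuousOn (fun x => (harmonicEval p x / (ζ ^ 2 - (‖x‖ : ℂ) ^ 2) : ℂ))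
      (closedBall 0 R) :=
    .div (Complex.continuous_ofReal.comp (continuous_harmonicEval p)).continuousOn (by fun_prop)
      fun x hx => sq_sub_ofReal_sq_ne_zero (norm_nonneg x)
        ((mem_closedBall_zero_iff.1 hx).trans_lt hζ)
  obtain ⟨C, hC⟩ := (isCompact_closedBall 0 R).exists_bound_of_continuousOn hcont
  exact integrable_signedMeasure_of_bound μ
    (Measurable.aestronglyMeasurable (by fun_prop))
    (hμ.mono fun x hx => hC x (mem_closedBall_zero_iff.2 hx))

/-- The `(k, ℓ)` term of the expansion of the Stieltjes-Markov transform of `μ`, indexed by pairs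
`a = (k, ℓ)`. -/
noncomputable def momentTerm
    (Y : ∀ k : ℕ, Module.Basis (Fin (harmonicDim n k)) ℝ (harmonicSpace n k))
    (μ : SignedMeasure (EucSpace n)) (R : ℝ) (ζ : ℂ) (θ : EucSpace n)
    (a : Σ k : ℕ, Fin (harmonicDim n k)) : ℂ :=
  ζ ^ (-(a.1 : ℤ) + 1) * (harmonicEval (Y a.1 a.2) θ : ℂ) *
    ∫ᵛ r in Icc 0 R, (r : ℂ) ^ a.1 / (ζ ^ 2 - (r : ℂ) ^ 2) ∂<•(componentMeasure μ (Y a.1 a.2))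

variable {Y : ∀ k : ℕ, Module.Basis (Fin (harmonicDim n k)) ℝ (harmonicSpace n k)}

theorem integral_kernelTerm (hμ : ∀ᵐ x ∂μ.variation, ‖x‖ ≤ R) (hζ : R < ‖ζ‖) (θ : EucSpace n)
    (a : Σ k : ℕ, Fin (harmonicDim n k)) :
    ∫ᵛ x, kernelTerm Y ζ θ x a ∂<•μ = momentTerm Y μ R ζ θ a := by
  rw [momentTerm, setIntegral_componentMeasure_pow_div hμ hζ]
  exact integral_signedMeasure_clm_apply (ContinuousLinearMap.mul ℝ ℂ _)
    (integrable_harmonicEval_div_sq_sub_sq hμ hζ _)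

namespace IsOrthonormalHarmonicBasis

variable [NeZero n]

theorem integrable_huaAronszajnKernel (hY : IsOrthonormalHarmonicBasis n Y)
    (hμ : ∀ᵐ x ∂μ.variation, ‖x‖ ≤ R) (hζ : R < ‖ζ‖) {θ : EucSpace n} (hθ : ‖θ‖ = 1) :
    VectorMeasure.Integrable μ (huaAronszajnKernel n ζ θ) :=
  integrable_signedMeasure_of_bound μ (measurable_huaAronszajnKernel ζ θ).aestronglyMeasurable
    (hμ.mono fun _ hx => hY.norm_huaAronszajnKernel_le hθ hx hζ)

theorem hasSum_momentTerm (hY : IsOrthonormalHarmonicBasis n Y) (hR : 0 ≤ R)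
    (hμ : ∀ᵐ x ∂μ.variation, ‖x‖ ≤ R) (hζ : R < ‖ζ‖) (θ : UnitSphere n) :
    HasSum (momentTerm Y μ R ζ θ) (stieltjesMarkov μ ζ θ) := by
  have hθ : ‖(θ : EucSpace n)‖ = 1 := norm_eq_of_mem_sphere θ
  have hsum := hasSum_integral_signedMeasure_of_bound
    (fun a => (measurable_kernelTerm (Y := Y) ζ θ a).aestronglyMeasurable)
    (fun a => hμ.mono fun x hx => hY.norm_kernelTerm_le hθ hx hζ le_rfl a)
    (hY.summable_kernelTerm_bound hR hζ)
    (hμ.mono fun x hx => hY.hasSum_kernelTerm hθ (hx.trans_lt hζ))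
  exact hsum.congr_fun fun a => (integral_kernelTerm hμ hζ θ a).symm

theorem norm_momentTerm_le (hY : IsOrthonormalHarmonicBasis n Y)
    (hμ : ∀ᵐ x ∂μ.variation, ‖x‖ ≤ R) {R' : ℝ} (hR : R < R') (hζ : R' ≤ ‖ζ‖) (θ : UnitSphere n)
    (a : Σ k : ℕ, Fin (harmonicDim n k)) :
    ‖momentTerm Y μ R ζ θ a‖ ≤ (R' - R)⁻¹ * ((R / R') ^ a.1 * harmonicDim n a.1) *
      ‖(ContinuousLinearMap.lsmul ℝ ℝ : ℝ →L[ℝ] ℂ →L[ℝ] ℂ).flip‖ * μ.variation.real univ := by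
  have := isFiniteMeasure_variation μ
  rw [← integral_kernelTerm hμ (hR.trans_le hζ)]
  exact VectorMeasure.norm_integral_le_of_norm_le_const
    (hμ.mono fun x hx => hY.norm_kernelTerm_le (norm_eq_of_mem_sphere θ) hx hR hζ a)

theorem exists_summable_norm_momentTerm_le (hY : IsOrthonormalHarmonicBasis n Y) (hR : 0 < R)
    (hμ : ∀ᵐ x ∂μ.variation, ‖x‖ ≤ R) {K : Set (KDQ n)} (hK : IsCompact K)
    (hKR : K ⊆ (closure (KDQ.ball n R))ᶜ) :
    ∃ M : (Σ k : ℕ, Fin (harmonicDim n k)) → ℝ, Summable M ∧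
      ∀ (ζ : ℂ) (θ : UnitSphere n), KDQ.mk ζ θ ∈ K → ∀ a, ‖momentTerm Y μ R ζ θ a‖ ≤ M a := by
  obtain ⟨R', hRR', hKR'⟩ := KDQ.exists_lt_norm_of_isCompact hR.ne' hK hKR
  exact ⟨_, ((hY.summable_kernelTerm_bound hR.le hRR').mul_right _).mul_right _,
    fun ζ θ hmem a => hY.norm_momentTerm_le hμ hRR' (hKR' ζ θ hmem) θ a⟩

end IsOrthonormalHarmonicBasis

end MomentSeries

theorem mainTheorem4_general (n : ℕ) [NeZero n]
    (Y : ∀ k : ℕ, Module.Basis (Fin (harmonicDim n k)) ℝ (harmonicSpace n k))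
    (hY : IsOrthonormalHarmonicBasis n Y)
    (R : ℝ) (hR : 0 < R)
    (μ : SignedMeasure (EucSpace n))
    (hμ : μ.totalVariation (closedBall (0 : EucSpace n) R)ᶜ = 0) :
    (∀ ζ : ℂ, R < ‖ζ‖ → ∀ θ : UnitSphere n,
      VectorMeasure.Integrable μ (fun x => huaAronszajnKernel n ζ θ x) ∧
      (∀ (k : ℕ) (l : Fin (harmonicDim n k)),
        VectorMeasure.IntegrableOn (componentMeasure μ (Y k l))
          (fun r : ℝ => (r : ℂ) ^ k / (ζ ^ 2 - (r : ℂ) ^ 2)) (Icc 0 R)) ∧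
      HasSum
        (fun a : Σ k : ℕ, Fin (harmonicDim n k) =>
          ζ ^ (-(a.1 : ℤ) + 1) * (harmonicEval (Y a.1 a.2) θ : ℂ) *
            ∫ᵛ r in Icc 0 R, (r : ℂ) ^ a.1 / (ζ ^ 2 - (r : ℂ) ^ 2)
              ∂<•(componentMeasure μ (Y a.1 a.2)))
        (stieltjesMarkov μ ζ θ)) ∧
    (∀ K : Set (KDQ n), IsCompact K → K ⊆ (closure (KDQ.ball n R))ᶜ →
      ∃ M : (Σ k : ℕ, Fin (harmonicDim n k)) → ℝ, Summable M ∧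
        ∀ (ζ : ℂ) (θ : UnitSphere n), KDQ.mk ζ θ ∈ K →
          ∀ a : Σ k : ℕ, Fin (harmonicDim n k),
            ‖ζ ^ (-(a.1 : ℤ) + 1) * (harmonicEval (Y a.1 a.2) θ : ℂ) *
              ∫ᵛ r in Icc 0 R, (r : ℂ) ^ a.1 / (ζ ^ 2 - (r : ℂ) ^ 2)
                ∂<•(componentMeasure μ (Y a.1 a.2))‖ ≤ M a) := by
  have hae : ∀ᵐ x ∂μ.variation, ‖x‖ ≤ R := by
    rw [SignedMeasure.totalVariation_eq_variation] at hμ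
    filter_upwards [measure_eq_zero_iff_ae_notMem.1 hμ] with x hx
    exact mem_closedBall_zero_iff.1 (notMem_compl_iff.1 hx)
  exact ⟨fun ζ hζ θ =>
    ⟨hY.integrable_huaAronszajnKernel hae hζ (norm_eq_of_mem_sphere θ),
      fun k l => integrableOn_componentMeasure_pow_div hζ (Y k l),
      hY.hasSum_momentTerm hR.le hae hζ θ⟩,
    fun K hK hKR => hY.exists_summable_norm_momentTerm_le hR hae hK hKR⟩

theorem mainTheorem4 (n : ℕ) (hn : 2 ≤ n)
    (Y : ∀ k : ℕ, Module.Basis (Fin (harmonicDim n k)) ℝ (harmonicSpace n k))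
    (hY : IsOrthonormalHarmonicBasis n Y)
    (R : ℝ) (hR : 0 < R)
    (μ : SignedMeasure (EucSpace n))
    (hμ : μ.totalVariation (closedBall (0 : EucSpace n) R)ᶜ = 0) :
    (∀ ζ : ℂ, R < ‖ζ‖ → ∀ θ : UnitSphere n,
      VectorMeasure.Integrable μ (fun x => huaAronszajnKernel n ζ θ x) ∧
      (∀ (k : ℕ) (l : Fin (harmonicDim n k)),
        VectorMeasure.IntegrableOn (componentMeasure μ (Y k l))
          (fun r : ℝ => (r : ℂ) ^ k / (ζ ^ 2 - (r : ℂ) ^ 2)) (Icc 0 R)) ∧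
      HasSum
        (fun a : Σ k : ℕ, Fin (harmonicDim n k) =>
          ζ ^ (-(a.1 : ℤ) + 1) * (harmonicEval (Y a.1 a.2) θ : ℂ) *
            ∫ᵛ r in Icc 0 R, (r : ℂ) ^ a.1 / (ζ ^ 2 - (r : ℂ) ^ 2)
              ∂<•(componentMeasure μ (Y a.1 a.2)))
        (stieltjesMarkov μ ζ θ)) ∧
    (∀ K : Set (KDQ n), IsCompact K → K ⊆ (closure (KDQ.ball n R))ᶜ →
      ∃ M : (Σ k : ℕ, Fin (harmonicDim n k)) → ℝ, Summable M ∧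
        ∀ (ζ : ℂ) (θ : UnitSphere n), KDQ.mk ζ θ ∈ K →
          ∀ a : Σ k : ℕ, Fin (harmonicDim n k),
            ‖ζ ^ (-(a.1 : ℤ) + 1) * (harmonicEval (Y a.1 a.2) θ : ℂ) *
              ∫ᵛ r in Icc 0 R, (r : ℂ) ^ a.1 / (ζ ^ 2 - (r : ℂ) ^ 2)
                ∂<•(componentMeasure μ (Y a.1 a.2))‖ ≤ M a) := by
  have : NeZero n := ⟨by omega⟩
  exact mainTheorem4_general n Y hY R hR μ hμ
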